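/- **Notation.** Let $\mathcal X$ be a measurable space, $\mathcal Y=\{1,-1\}$, $\mathcal F$ a class of measurable functions $\mathcal X\to\mathcal Y$ with finite VC dimension $d\ge 1$, and $n\ge 1$. Throughout, $\log x:=\ln(\max(x,e))$ and $a\wedge b:=\min(a,b)$. The star number $\mathbf s\in\mathbb N\cup\{\infty\}$ of $\mathcal F$ is the supremum of the integers $k$ for which there are distinct $x_1,\dots,x_k\in\mathcal X$ and $f_0,f_1,\dots,f_k\in\mathcal F$ such that, for each $i$, $x_i$ is the only point of $\{x_1,\dots,x_k\}$ at which $f_0$ and $f_i$ differ. For $x_1,\dots,x_n\in\mathcal X$ (repetitions allowed) let $\rho_H(f,g)=|\{i: f(x_i)\ne g(x_i)\}|$ and $\mathcal B_H(f,r,\{x_1,\dots,x_n\})=\{g\in\mathcal F:\rho_H(f,g)\le r\}$, and let $\mathcal M_1(\mathcal H,\varepsilon)$ be the largest size of a subset of $\mathcal H$ whose distinct elements have pairwise distances $\rho_H>\varepsilon$. Put $$\mathcal M_1^{\mathrm{loc}}(\mathcal F,\gamma,n,h)=\max_{x_1,\dots,x_n}\ \max_{f\in\mathcal F}\ \max_{\varepsilon\ge\gamma}\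 \mathcal M_1\bigl(\mathcal B_H(f,\varepsilon/h,\{x_1,\dots,x_n\}),\varepsilon/2\bigr),$$ $$\gamma^{\mathrm{loc}}_{h,h'}(n)=\max\{\gamma\in\mathbb N: h\gamma\le\log\mathcal M_1^{\mathrm{loc}}(\mathcal F,\gamma,n,h')\}.$$ For a probability measure $P$ on $\mathcal X\times\mathcal Y$ and $(X,Y)\sim P$, let $R(f)=P(f(X)\ne Y)$, $\eta(x)=\mathbb E[Y\mid X=x]$ and $f^*=\operatorname{sign}\eta$ (the Bayes classifier). $P\in\mathcal P(h,\mathcal F)$ (Massart's bounded noise condition with margin $h$) means that $\mathcal F$ contains a version of $f^*$ and $|\eta(X)|\ge h$ almost surely. An ERM $\hat f$ maps each sample $(X_i,Y_i)_{i\le n}$ to an element of $\mathcal F$ that minimizes the number of sample errors $|\{i: f(X_i)\ne Y_i\}|$ over $f\in\mathcal F$. **Theorem.** There is a universal constant $C>0$ such that the following holds for all $\mathcal X,\mathcal F,d,n$ as above and every $h\in(\sqrt{d/n},1]$. 1. Let $P\in\mathcal P(h,\mathcal F)$, let the sample be i.i.d. from $P$, and let $\hat f$ be any ERM. Assume the usual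 measurability: $R(\hat f)$ is a random variable and, for all $m$ and all real weights $w_1,\dots,w_m$, so is $\sup_{f\in\mathcal F}\sum_{i\le m}w_i\mathbf 1[f(X_i)\ne Y_i]$ for an i.i.d. sample of size $m$ from $P$ (on the completed probability space). Then $$\mathbb E\bigl(R(\hat f)-R(f^*)\bigr)\le C\,\frac{\gamma^{\mathrm{loc}}_{h,h}(n)}{n},$$ and for every $\delta\in(0,1)$, with probability at least $1-\delta$, $$R(\hat f)-R(f^*)\le C\left(\frac{\gamma^{\mathrm{loc}}_{h,h}(n)}{n}+\frac{\log(1/\delta)}{nh}\right).$$ 2. Moreover, $$\frac{d+\log(nh^2\wedge\mathbf s)}{h}\le C\,\gamma^{\mathrm{loc}}_{h,h}(n)\qquad\text{and}\qquad \gamma^{\mathrm{loc}}_{h,h}(n)\le C\left(\frac{d\log\bigl(\frac{nh^2}{d}\wedge\mathbf s\bigr)}{h}+\frac{d\log(1/h)}{h}\right).$$ -/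

import Mathlib

open MeasureTheory ProbabilityTheory
open scoped NNReal ENNReal

noncomputable section

namespace LocalEntropy

/-- The truncated logarithm `ln (max x e)`. -/
def tlog (x : ℝ) : ℝ := Real.log (max x (Real.exp 1))

/-- The minimum of a real number and an extended natural number. -/
def minENat (t : ℝ) (s : ℕ∞) : ℝ := if s = ⊤ then t else min t (s.toNat : ℝ)

/-- The numerical value of a label: the label set `{1, -1}` is encoded by `Bool`. -/
def label (b : Bool) : ℝ := if b then 1 else -1

section Combinatorics

variable {X : Type*}

/-- Every labelling of the finite set `A` is realized by a classifier in `F`. -/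
def Shatters (F : Set (X → Bool)) (A : Finset X) : Prop :=
  ∀ b : X → Bool, ∃ f ∈ F, ∀ x ∈ A, f x = b x

/-- The VC dimension. -/
def vcDim (F : Set (X → Bool)) : ℕ∞ :=
  ⨆ (A : Finset X) (_ : Shatters F A), (A.card : ℕ∞)

/-- The region of disagreement of a set of classifiers. -/
def DIS (B : Set (X → Bool)) : Set X := {x | ∃ f ∈ B, ∃ g ∈ B, f x ≠ g x}

/-- There are `k` distinct points and a star of `k + 1` classifiers of `F` on them. -/
def HasStar (F : Set (X → Bool)) (k : ℕ) : Prop :=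
  ∃ (x : Fin k → X) (f₀ : X → Bool) (f : Fin k → X → Bool),
    Function.Injective x ∧ f₀ ∈ F ∧ (∀ i, f i ∈ F) ∧
      ∀ i, DIS {f₀, f i} ∩ Set.range x = {x i}

/-- The star number. -/
def starNumber (F : Set (X → Bool)) : ℕ∞ := ⨆ (k : ℕ) (_ : HasStar F k), (k : ℕ∞)

/-- The vector of values of a classifier on `x₁, …, xₙ` (repetitions allowed), in the Hamming
cube; the distance between two such vectors is the number of indices where they differ. -/
def proj {n : ℕ} (x : Fin n → X) (f : X → Bool) : Hamming (fun _ : Fin n => Bool) :=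
  Hamming.toHamming (fun i => f (x i))

/-- The empirical Hamming ball in `F` of radius `r` around `f`. -/
def hammingBall (F : Set (X → Bool)) {n : ℕ} (x : Fin n → X) (f : X → Bool) (r : ℝ) :
    Set (X → Bool) :=
  {g ∈ F | dist (proj x f) (proj x g) ≤ r}

/-- The worst-case local empirical packing number. -/
def locPacking (F : Set (X → Bool)) (γ n : ℕ) (h : ℝ) : ℕ∞ :=
  ⨆ (x : Fin n → X) (f : X → Bool) (_ : f ∈ F) (ε : ℝ≥0) (_ : (γ : ℝ≥0) ≤ ε),
    Metric.packingNumber (ε / 2) (proj x '' hammingBall F x f (ε / h))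

/-- The fixed point of the local empirical entropy. The packing numbers are at most `2 ^ n`,
so that for `0 < h` the set below is finite, and its supremum is its maximum. -/
def gammaLoc (F : Set (X → Bool)) (n : ℕ) (h h' : ℝ) : ℕ :=
  sSup {γ : ℕ | h * γ ≤ tlog ((locPacking F γ n h').toNat : ℝ)}

end Combinatorics

section Learning

variable {X : Type*} [MeasurableSpace X]

/-- The risk (probability of error) of a classifier. -/
def risk (P : Measure (X × Bool)) (f : X → Bool) : ℝ := P.real {z | f z.1 ≠ z.2}

/-- The empirical risk of a classifier on a sample. -/
def empRisk {n : ℕ} (z : Fin n → X × Bool) (f : X → Bool) : ℝ :=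
  (∑ i, if f (z i).1 ≠ (z i).2 then (1 : ℝ) else 0) / n

/-- The regression function `η x = E[Y | X = x]`. -/
def regression (P : Measure (X × Bool)) [IsFiniteMeasure P] (x : X) : ℝ :=
  ∫ y, label y ∂(P.condKernel x)

/-- The Bayes classifier `sign ∘ η`. -/
def bayes (P : Measure (X × Bool)) [IsFiniteMeasure P] (x : X) : Bool :=
  decide (0 ≤ regression P x)

/-- Massart's bounded noise condition with margin `h`. As `η` is determined only up to a null
set of the law of `X`, so is the Bayes classifier, and a version of it has to be in `F`. -/
def Massart (P : Measure (X × Bool)) [IsFiniteMeasure P] (F : Set (X → Bool)) (h : ℝ) : Prop :=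
  (∃ f ∈ F, f =ᵐ[P.fst] bayes P) ∧ ∀ᵐ x ∂P.fst, h ≤ |regression P x|

/-- The law of an i.i.d. sample of size `n`. -/
abbrev sampleLaw (P : Measure (X × Bool)) (n : ℕ) : Measure (Fin n → X × Bool) :=
  Measure.pi fun _ => P

/-- The loss class of `F` is a measurable class for `P`: suprema over the class of weighted sums
of losses along an i.i.d. sample are random variables (on the completed probability space). -/
def IsMeasurableClass (P : Measure (X × Bool)) (F : Set (X → Bool)) : Prop :=
  ∀ (m : ℕ) (w : Fin m → ℝ),
    AEMeasurable
      (fun z : Fin m → X × Bool =>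
        ⨆ f : F, ∑ i, w i * (if (f : X → Bool) (z i).1 ≠ (z i).2 then (1 : ℝ) else 0))
      (sampleLaw P m)

/-- `A` is an empirical risk minimization algorithm over `F` for samples of size `n`. -/
def IsERM (F : Set (X → Bool)) {n : ℕ} (A : (Fin n → X × Bool) → X → Bool) : Prop :=
  ∀ z, A z ∈ F ∧ ∀ f ∈ F, empRisk z (A z) ≤ empRisk z f

end Learning

end LocalEntropy

end

/-! Upper bound on the risk. Let `f₀` be the version of the Bayes classifier in the class. Under the
margin condition the mean excess loss of `f` is at least `h` times the probability that `f` and `f₀`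
disagree, while an ERM has nonpositive total empirical excess loss. Hence `n` times its excess risk
is at most the mean, over an independent ghost sample, of a two-sample sum containing the negative
term `-h * disagree` (`mul_excess_risk_le_integral`). Jensen's inequality passes to exponentials and
to the supremum over the class. Exchanging the two samples coordinatewise at random preserves the
law and, for a fixed pair of samples, turns the sum into two sign processes with drift `-h / 2` on
each index of disagreement (`ghostSum_swapSamples`).

The exponential moment of such a process is controlled by `exists_exp_offset_bound`. The class is
split into dyadic shells around `f₀`, each covered at a fixed fraction of its scale. The logarithm
of the cover size is at most `7 * h * γ`, whereas the drift on the `k`-th shell gains an amount of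
order `2 ^ k * h * γ`. Only one scale per shell is needed, so there is no chaining. The result is an
exponential moment of order `exp (14 * h * γ)`, from which the expectation follows by Jensen and the
tail by Markov.

Lower bounds on the fixed point. Repeating each point of a finite configuration `k` times multiplies
all distances by `k`. A Gilbert–Varshamov code on a shattered set gives `d / h`, and the leaves of a
star give the logarithmic term (both through `mul_le_gammaLoc`).

Upper bound on the fixed point. A separated family remains distinct on a short random subsample of
its disagreement region, so Sauer–Shelah bounds its size through the ratio of the region to the
separation (`log_card_le_of_separated`). The region has at most `n` indices, and at most the star
number times the radius, because a minimal subfamily with the same union forms a star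
(`card_biUnion_diff_le_star`). -/

open MeasureTheory ProbabilityTheory
open scoped NNReal ENNReal

noncomputable section

namespace LocalEntropy

/-! ### Empirical distances, packings, covers, and the fixed point -/

section Basic

variable {X : Type*}

/-- The indices of the sample at which two classifiers differ. -/
def diff {n : ℕ} (x : Fin n → X) (f g : X → Bool) : Finset (Fin n) :=
  Finset.univ.filter fun i => f (x i) ≠ g (x i)

theorem mem_diff {n : ℕ} {x : Fin n → X} {f g : X → Bool} {i : Fin n} :
    i ∈ diff x f g ↔ f (x i) ≠ g (x i) := by simp [diff]

theorem diff_comm {n : ℕ} (x : Fin n → X) (f g : X → Bool) : diff x f g = diff x g f := by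
  ext i; simp [mem_diff, ne_comm]

theorem dist_proj {n : ℕ} (x : Fin n → X) (f g : X → Bool) :
    dist (proj x f) (proj x g) = ((diff x f g).card : ℝ) := by
  rw [Hamming.dist_eq_hammingDist]
  rfl

theorem card_diff_triangle {n : ℕ} (x : Fin n → X) (f g k : X → Bool) :
    ((diff x f k).card : ℝ) ≤ (diff x f g).card + (diff x g k).card := by
  rw [← dist_proj, ← dist_proj, ← dist_proj]
  exact dist_triangle _ _ _

theorem mem_hammingBall {F : Set (X → Bool)} {n : ℕ} {x : Fin n → X} {f g : X → Bool} {r : ℝ} :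
    g ∈ hammingBall F x f r ↔ g ∈ F ∧ ((diff x f g).card : ℝ) ≤ r := by
  rw [← dist_proj]; rfl

theorem lt_edist_proj {n : ℕ} {x : Fin n → X} {f g : X → Bool} {r : ℝ≥0} :
    (r : ℝ≥0∞) < edist (proj x f) (proj x g) ↔ (r : ℝ) < (diff x f g).card := by
  rw [← dist_proj, edist_nndist, ENNReal.coe_lt_coe, ← NNReal.coe_lt_coe, coe_nndist]

theorem card_le_locPacking {F : Set (X → Bool)} {γ n : ℕ} {h ε : ℝ} {κ : Type*} [Fintype κ]
    (x : Fin n → X) {f₀ : X → Bool} (hf₀ : f₀ ∈ F) (hε : (γ : ℝ) ≤ ε) (g : κ → X → Bool)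
    (hg : ∀ c, g c ∈ F) (hball : ∀ c, ((diff x f₀ (g c)).card : ℝ) ≤ ε / h)
    (hsep : ∀ c c', c ≠ c' → ε / 2 < (diff x (g c) (g c')).card) :
    (Fintype.card κ : ℕ∞) ≤ locPacking F γ n h := by
  have hε0 : 0 ≤ ε := (Nat.cast_nonneg γ).trans hε
  lift ε to ℝ≥0 using hε0
  refine le_trans ?_ (le_iSup_of_le x (le_iSup_of_le f₀ (le_iSup_of_le hf₀
    (le_iSup_of_le ε (le_iSup_of_le (by exact_mod_cast hε) le_rfl)))))
  have hinj : Function.Injective fun c => proj x (g c) := by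
    intro c c' hcc
    by_contra hne
    have h1 := hsep c c' hne
    rw [← dist_proj] at h1
    simp only at hcc
    rw [hcc, dist_self] at h1
    have : (0 : ℝ) ≤ ε := ε.2
    linarith
  have hcard : (Fintype.card κ : ℕ∞) = (Set.range fun c => proj x (g c)).encard := by
    rw [← Set.image_univ, hinj.encard_image, Set.encard_univ, ENat.card_eq_coe_fintype_card]
  rw [hcard]
  apply Metric.IsSeparated.encard_le_packingNumber
  · rintro _ ⟨c, rfl⟩
    exact ⟨g c, mem_hammingBall.2 ⟨hg c, hball c⟩, rfl⟩
  · rintro _ ⟨c, rfl⟩ _ ⟨c', rfl⟩ hne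
    rw [lt_edist_proj]
    push_cast
    exact hsep c c' fun hc => hne (by rw [hc])

theorem packingNumber_le_two_pow {n : ℕ} (ε : ℝ≥0) (A : Set (Hamming fun _ : Fin n => Bool)) :
    Metric.packingNumber ε A ≤ ((2 ^ n : ℕ) : ℕ∞) := by
  refine (Metric.packingNumber_le_encard_self A).trans ?_
  refine (Set.encard_le_encard (Set.subset_univ A)).trans ?_
  rw [Set.encard_univ, ENat.card_congr (Hamming.ofHamming : Hamming (fun _ : Fin n => Bool) ≃ _),
    ENat.card_eq_coe_fintype_card]
  simp

theorem locPacking_le_two_pow (F : Set (X → Bool)) (γ n : ℕ) (h : ℝ) :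
    locPacking F γ n h ≤ ((2 ^ n : ℕ) : ℕ∞) :=
  iSup_le fun _ => iSup_le fun _ => iSup_le fun _ => iSup_le fun _ => iSup_le fun _ =>
    packingNumber_le_two_pow _ _

theorem locPacking_ne_top (F : Set (X → Bool)) (γ n : ℕ) (h : ℝ) : locPacking F γ n h ≠ ⊤ :=
  ne_top_of_le_ne_top (ENat.natCast_ne_top _) (locPacking_le_two_pow F γ n h)

/-- Points of a packing in the cube are lifted to classifiers, so that later upper bounds can argue
with finite subfamilies of `F`. -/
theorem locPacking_toNat_le {F : Set (X → Bool)} {γ n : ℕ} {h : ℝ} (B : ℕ)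
    (hB : ∀ (x : Fin n → X) (f : X → Bool) (ε : ℝ) (G : Finset (X → Bool)), f ∈ F →
      (γ : ℝ) ≤ ε → (∀ g ∈ G, g ∈ F) → (∀ g ∈ G, ((diff x f g).card : ℝ) ≤ ε / h) →
      (∀ g ∈ G, ∀ g' ∈ G, g ≠ g' → ε / 2 < (diff x g g').card) → G.card ≤ B) :
    (locPacking F γ n h).toNat ≤ B := by
  classical
  refine ENat.toNat_le_of_le_natCast (iSup_le fun x => iSup_le fun f => iSup_le fun hf =>
    iSup_le fun ε => iSup_le fun hε => iSup_le fun C => iSup_le fun hC => iSup_le fun hsep => ?_)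
  have hfin : C.Finite := by
    have : (Set.encard C) ≤ ((2 ^ n : ℕ) : ℕ∞) := by
      rw [← Metric.packingNumber_zero C]; exact packingNumber_le_two_pow _ _
    exact Set.finite_of_encard_le_coe this
  choose! u hu using hC
  have hinj : Set.InjOn u hfin.toFinset := by
    intro a ha b hb hab
    have ha' := hu (hfin.mem_toFinset.1 ha)
    have hb' := hu (hfin.mem_toFinset.1 hb)
    rw [← ha'.2, ← hb'.2, hab]
  have key := hB x f ε (hfin.toFinset.image u) hf (by exact_mod_cast hε)
    (by
      intro g hg
      obtain ⟨c, hc, rfl⟩ := Finset.mem_image.1 hg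
      exact (hu (hfin.mem_toFinset.1 hc)).1.1)
    (by
      intro g hg
      obtain ⟨c, hc, rfl⟩ := Finset.mem_image.1 hg
      exact (mem_hammingBall.1 (hu (hfin.mem_toFinset.1 hc)).1).2)
    (by
      intro g hg g' hg' hne
      obtain ⟨c, hc, rfl⟩ := Finset.mem_image.1 hg
      obtain ⟨c', hc', rfl⟩ := Finset.mem_image.1 hg'
      have h1 := hsep (hfin.mem_toFinset.1 hc) (hfin.mem_toFinset.1 hc')
        (fun hcc => hne (by rw [hcc]))
      rw [← (hu (hfin.mem_toFinset.1 hc)).2, ← (hu (hfin.mem_toFinset.1 hc')).2,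
        lt_edist_proj] at h1
      exact_mod_cast h1)
  rw [Finset.card_image_of_injOn hinj] at key
  rw [hfin.encard_eq_coe_toFinset_card]
  exact_mod_cast key

/-- A maximal separated set is a cover. The centres are values of members of the ball, hence lift to
`F`, which allows the covering to be iterated. -/
theorem exists_cover {F : Set (X → Bool)} {γ n : ℕ} {h ε : ℝ} (x : Fin n → X) {f : X → Bool}
    (hf : f ∈ F) (hε : (γ : ℝ) ≤ ε) :
    ∃ G : Finset (X → Bool), (∀ g ∈ G, g ∈ F) ∧ G.card ≤ (locPacking F γ n h).toNat ∧
      ∀ g ∈ F, ((diff x f g).card : ℝ) ≤ ε / h → ∃ g' ∈ G, ((diff x g g').card : ℝ) ≤ ε / 2 := by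
  classical
  have hε0 : 0 ≤ ε := (Nat.cast_nonneg γ).trans hε
  lift ε to ℝ≥0 using hε0
  set S := proj x '' hammingBall F x f (ε / h) with hS
  have hle : Metric.packingNumber (ε / 2) S ≤ locPacking F γ n h :=
    le_iSup_of_le x (le_iSup_of_le f (le_iSup_of_le hf
      (le_iSup_of_le ε (le_iSup_of_le (by exact_mod_cast hε) le_rfl))))
  have hc : Metric.coveringNumber (ε / 2) S ≤ locPacking F γ n h :=
    (Metric.coveringNumber_le_packingNumber _ _).trans hle
  obtain ⟨C, hCS, hfin, hcov, hcard⟩ := Metric.exists_set_encard_eq_coveringNumber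
    (ne_top_of_le_ne_top (locPacking_ne_top F γ n h) hc)
  have hpre : ∀ c ∈ C, ∃ g, g ∈ hammingBall F x f (ε / h) ∧ proj x g = c := fun c hc => hCS hc
  choose! u hu using hpre
  refine ⟨hfin.toFinset.image u, ?_, ?_, ?_⟩
  · intro g hg
    obtain ⟨c, hc, rfl⟩ := Finset.mem_image.1 hg
    exact (hu c (hfin.mem_toFinset.1 hc)).1.1
  · refine Finset.card_image_le.trans ?_
    rw [← hcard, hfin.encard_eq_coe_toFinset_card] at hc
    simpa using ENat.toNat_le_toNat hc (locPacking_ne_top F γ n h)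
  · intro g hg hfg
    obtain ⟨c, hcC, hdist⟩ := hcov (x := proj x g) ⟨g, mem_hammingBall.2 ⟨hg, hfg⟩, rfl⟩
    refine ⟨u c, Finset.mem_image_of_mem _ (hfin.mem_toFinset.2 hcC), ?_⟩
    have h2 : edist (proj x g) c ≤ ((ε / 2 : ℝ≥0) : ℝ≥0∞) := hdist
    rw [← (hu c hcC).2, edist_nndist, ENNReal.coe_le_coe, ← NNReal.coe_le_coe, coe_nndist,
      dist_proj] at h2
    exact_mod_cast h2

theorem one_le_tlog (x : ℝ) : 1 ≤ tlog x := by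
  rw [tlog, Real.le_log_iff_exp_le (lt_max_of_lt_right (Real.exp_pos 1))]
  exact le_max_right _ _

theorem tlog_mono {x y : ℝ} (hxy : x ≤ y) : tlog x ≤ tlog y :=
  Real.log_le_log (lt_max_of_lt_right (Real.exp_pos 1)) (max_le_max_right _ hxy)

theorem log_le_tlog {x : ℝ} (hx : 0 < x) : Real.log x ≤ tlog x :=
  Real.log_le_log hx (le_max_left _ _)

theorem exp_tlog (x : ℝ) : Real.exp (tlog x) = max x (Real.exp 1) :=
  Real.exp_log (lt_max_of_lt_right (Real.exp_pos 1))

theorem le_exp_tlog (x : ℝ) : x ≤ Real.exp (tlog x) := by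
  rw [exp_tlog]; exact le_max_left _ _

theorem tlog_le_of_le_exp {x b : ℝ} (hb : 1 ≤ b) (hx : x ≤ Real.exp b) : tlog x ≤ b := by
  rw [tlog, Real.log_le_iff_le_exp (lt_max_of_lt_right (Real.exp_pos 1))]
  exact max_le hx (Real.exp_le_exp.2 hb)

variable {F : Set (X → Bool)} {n : ℕ} {h h' : ℝ}

theorem bddAbove_gammaLoc_set (hh : 0 < h) :
    BddAbove {γ : ℕ | h * γ ≤ tlog ((locPacking F γ n h').toNat : ℝ)} := by
  refine ⟨⌊tlog ((2 ^ n : ℕ) : ℝ) / h⌋₊, fun γ hγ => Nat.le_floor ?_⟩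
  rw [le_div_iff₀ hh, mul_comm]
  refine le_trans hγ (tlog_mono ?_)
  exact_mod_cast ENat.toNat_le_of_le_natCast (locPacking_le_two_pow F γ n h')

theorem le_gammaLoc (hh : 0 < h) {γ : ℕ} (hγ : h * γ ≤ tlog ((locPacking F γ n h').toNat : ℝ)) :
    γ ≤ gammaLoc F n h h' :=
  le_csSup (bddAbove_gammaLoc_set hh) hγ

theorem gammaLoc_spec (hh : 0 < h) :
    h * gammaLoc F n h h' ≤ tlog ((locPacking F (gammaLoc F n h h') n h').toNat : ℝ) :=
  Nat.sSup_mem (s := {γ : ℕ | h * γ ≤ tlog ((locPacking F γ n h').toNat : ℝ)})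
    ⟨0, by simpa using zero_le_one.trans (one_le_tlog _)⟩ (bddAbove_gammaLoc_set hh)

theorem tlog_lt_succ_gammaLoc (hh : 0 < h) :
    tlog ((locPacking F (gammaLoc F n h h' + 1) n h').toNat : ℝ)
      < h * (gammaLoc F n h h' + 1 : ℕ) := by
  by_contra hcon
  have := le_gammaLoc hh (not_lt.1 hcon)
  omega

theorem one_le_gammaLoc (hh : 0 < h) (hh1 : h ≤ 1) : 1 ≤ gammaLoc F n h h' :=
  le_gammaLoc hh (by simpa using hh1.trans (one_le_tlog _))

/-- Because the truncated logarithm is at least 1, the integer `⌊1 / h⌋₊` always satisfies the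
defining inequality. This absorbs all small cases of the lower bounds. -/
theorem inv_le_two_mul_gammaLoc (hh : 0 < h) (hh1 : h ≤ 1) :
    1 / h ≤ 2 * (gammaLoc F n h h' : ℝ) := by
  have h1 : ⌊1 / h⌋₊ ≤ gammaLoc F n h h' := by
    refine le_gammaLoc hh (le_trans ?_ (one_le_tlog _))
    have := Nat.floor_le (one_div_pos.2 hh).le
    calc h * (⌊1 / h⌋₊ : ℝ) ≤ h * (1 / h) := by gcongr
      _ = 1 := by field_simp
  have h2 := Nat.lt_floor_add_one (1 / h)
  have h3 : ((⌊1 / h⌋₊ : ℕ) : ℝ) ≤ gammaLoc F n h h' := by exact_mod_cast h1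
  have h4 : (1 : ℝ) ≤ gammaLoc F n h h' := by exact_mod_cast one_le_gammaLoc hh hh1
  linarith

end Basic

/-! ### Lower bounds on the fixed point: shattered sets and stars -/

section LowerBound

variable {X : Type*}

/-- The unused sample slots are filled with `z`, where the compared classifiers agree, so they do
not affect distances. -/
theorem exists_repeated_sample {ι : Type*} [Fintype ι] (pts : ι → X) (z : X) {k n : ℕ}
    (hk : Fintype.card ι * k ≤ n) :
    ∃ x : Fin n → X, ∀ f g : X → Bool, f z = g z →
      (diff x f g).card = k * (Finset.univ.filter fun j => f (pts j) ≠ g (pts j)).card := by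
  classical
  obtain ⟨e⟩ : Nonempty (ι × Fin k ↪ Fin n) :=
    Function.Embedding.nonempty_of_card_le (by simpa using hk)
  refine ⟨Function.extend e (fun p => pts p.1) fun _ => z, fun f g hz => ?_⟩
  have : diff (Function.extend e (fun p => pts p.1) fun _ => z) f g =
      (((Finset.univ.filter fun j => f (pts j) ≠ g (pts j)) ×ˢ
        (Finset.univ : Finset (Fin k))).map e) := by
    ext i
    rw [mem_diff]
    by_cases hi : ∃ p, e p = i
    · obtain ⟨p, rfl⟩ := hi
      rw [e.injective.extend_apply]
      simp
    · rw [Function.extend_apply' _ _ _ hi]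
      simp only [hz, ne_eq, not_true, false_iff, Finset.mem_map, not_exists, not_and]
      exact fun p _ hp => hi ⟨p, hp⟩
  rw [this, Finset.card_map, Finset.card_product, mul_comm]
  simp

/-- On the repeated sample the family is a packing at scale `ε = k * w`: it lies within `k * w ≤ k *
w / h` of `f₀` and its distances exceed `k * w / 2`. -/
theorem mul_le_gammaLoc {F : Set (X → Bool)} {n : ℕ} {h : ℝ} {ι κ : Type*} [Fintype ι]
    [Fintype κ] [Nonempty κ] (pts : ι → X) (z : X) {k w : ℕ} (hk : 1 ≤ k)
    (hn : Fintype.card ι * k ≤ n) {f₀ : X → Bool} (hf₀ : f₀ ∈ F) (g : κ → X → Bool)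
    (hg : ∀ c, g c ∈ F) (hz : ∀ c, g c z = f₀ z)
    (hw : ∀ c, (Finset.univ.filter fun j => f₀ (pts j) ≠ g c (pts j)).card ≤ w)
    (hsep : ∀ c c', c ≠ c' →
      w < 2 * (Finset.univ.filter fun j => g c (pts j) ≠ g c' (pts j)).card)
    (hh : 0 < h) (hh1 : h ≤ 1) (hlog : h * (k * w : ℕ) ≤ Real.log (Fintype.card κ)) :
    k * w ≤ gammaLoc F n h h := by
  obtain ⟨x, hx⟩ := exists_repeated_sample pts z hn
  have hcard : (Fintype.card κ : ℕ∞) ≤ locPacking F (k * w) n h := by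
    refine card_le_locPacking x (ε := (k * w : ℕ)) hf₀ le_rfl g hg (fun c => ?_)
      (fun c c' hcc => ?_)
    · rw [hx f₀ (g c) (hz c).symm, le_div_iff₀ hh]
      calc ((k * _ : ℕ) : ℝ) * h ≤ ((k * _ : ℕ) : ℝ) * 1 := by gcongr
        _ ≤ ((k * w : ℕ) : ℝ) := by
          rw [mul_one]; exact_mod_cast Nat.mul_le_mul_left k (hw c)
    · rw [hx (g c) (g c') ((hz c).trans (hz c').symm), div_lt_iff₀ two_pos]
      have := Nat.mul_lt_mul_of_pos_left (hsep c c' hcc) hk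
      have h2 : ((k * w : ℕ) : ℝ) < ((k * (2 * (Finset.univ.filter
          fun j => g c (pts j) ≠ g c' (pts j)).card) : ℕ) : ℝ) := by exact_mod_cast this
      refine h2.trans_eq ?_
      push_cast
      ring
  refine le_gammaLoc hh (hlog.trans ((log_le_tlog (by exact_mod_cast Fintype.card_pos)).trans
    (tlog_mono ?_)))
  have := ENat.toNat_le_toNat hcard (locPacking_ne_top F (k * w) n h)
  exact_mod_cast (by simpa using this)

/-- Chernoff-type count: the indicator of the ball is at most `2 ^ w * 16 ^ (-dist)`, and the latter
sums coordinatewise. A coordinate contributes 1 for the match and `15 / 16` for the mismatches,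
giving `(2 * 31 / 16) ^ w`. -/
theorem card_hammingDist_le (w : ℕ) (c : Fin w → Fin 16) :
    (Finset.univ.filter fun v : Fin w → Fin 16 => 4 * hammingDist c v ≤ w).card ≤ 4 ^ w := by
  have hone : ∀ v : Fin w → Fin 16, 4 * hammingDist c v ≤ w →
      (1 : ℝ) ≤ 2 ^ w * ∏ i, (if c i ≠ v i then (1 / 16 : ℝ) else 1) := by
    intro v hv
    rw [Finset.prod_ite, Finset.prod_const, Finset.prod_const_one, mul_one]
    change 1 ≤ (2 : ℝ) ^ w * (1 / 16) ^ hammingDist c v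
    have h16 : (16 : ℝ) ^ hammingDist c v ≤ 2 ^ w := by
      calc (16 : ℝ) ^ hammingDist c v = 2 ^ (4 * hammingDist c v) := by
            rw [pow_mul]; norm_num
        _ ≤ 2 ^ w := pow_le_pow_right₀ (by norm_num) hv
    rw [one_div, inv_pow, ← div_eq_mul_inv, le_div_iff₀ (by positivity)]
    simpa using h16
  have hprod : ∑ v : Fin w → Fin 16, ∏ i, (if c i ≠ v i then (1 / 16 : ℝ) else 1)
      = (31 / 16) ^ w := by
    have h1 : ∀ i : Fin w, ∑ a : Fin 16, (if c i ≠ a then (1 / 16 : ℝ) else 1) = 31 / 16 := by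
      intro i
      have : ∀ a : Fin 16, (if c i ≠ a then (1 / 16 : ℝ) else 1)
          = 1 / 16 + if c i = a then (15 / 16 : ℝ) else 0 := by
        intro a; by_cases hca : c i = a <;> simp [hca]; norm_num
      simp_rw [this, Finset.sum_add_distrib, Finset.sum_ite_eq]
      norm_num
    have h2 := Finset.prod_univ_sum (fun _ : Fin w => (Finset.univ : Finset (Fin 16)))
      (fun i a => if c i ≠ a then (1 / 16 : ℝ) else 1)
    simp_rw [h1] at h2
    rw [Fintype.piFinset_univ] at h2
    rw [← h2, Finset.prod_const, Finset.card_univ, Fintype.card_fin]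
  have : ((Finset.univ.filter fun v : Fin w → Fin 16 => 4 * hammingDist c v ≤ w).card : ℝ)
      ≤ 4 ^ w := by
    calc ((Finset.univ.filter fun v : Fin w → Fin 16 => 4 * hammingDist c v ≤ w).card : ℝ)
        = ∑ v ∈ Finset.univ.filter fun v : Fin w → Fin 16 => 4 * hammingDist c v ≤ w, (1 : ℝ) := by
          simp
      _ ≤ ∑ v ∈ Finset.univ.filter fun v : Fin w → Fin 16 => 4 * hammingDist c v ≤ w,
            2 ^ w * ∏ i, (if c i ≠ v i then (1 / 16 : ℝ) else 1) :=
          Finset.sum_le_sum fun v hv => hone v (Finset.mem_filter.1 hv).2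
      _ ≤ ∑ v : Fin w → Fin 16, 2 ^ w * ∏ i, (if c i ≠ v i then (1 / 16 : ℝ) else 1) := by
          refine Finset.sum_le_sum_of_subset_of_nonneg (Finset.filter_subset _ _) fun v _ _ => ?_
          refine mul_nonneg (by positivity) (Finset.prod_nonneg fun i _ => ?_)
          split_ifs <;> norm_num
      _ = (2 * (31 / 16)) ^ w := by rw [← Finset.mul_sum, hprod, mul_pow]
      _ ≤ 4 ^ w := pow_le_pow_left₀ (by norm_num) (by norm_num) w
  exact_mod_cast this

/-- Gilbert–Varshamov: the balls around a code of maximal size cover all `16 ^ w` words, and each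
has at most `4 ^ w` elements. -/
theorem exists_code (w : ℕ) : ∃ C : Finset (Fin w → Fin 16), 4 ^ w ≤ C.card ∧
    ∀ c ∈ C, ∀ c' ∈ C, c ≠ c' → w < 4 * hammingDist c c' := by
  classical
  obtain ⟨C, hC, hmax⟩ := Finset.exists_max_image
    (Finset.univ.filter fun C : Finset (Fin w → Fin 16) =>
      ∀ c ∈ C, ∀ c' ∈ C, c ≠ c' → w < 4 * hammingDist c c') Finset.card ⟨∅, by simp⟩
  have hC' := (Finset.mem_filter.1 hC).2
  refine ⟨C, ?_, hC'⟩
  have hcover : (Finset.univ : Finset (Fin w → Fin 16)) ⊆ C.biUnion fun c =>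
      Finset.univ.filter fun v => 4 * hammingDist c v ≤ w := by
    intro v _
    by_contra hv
    have hfar : ∀ c ∈ C, w < 4 * hammingDist c v := by
      intro c hc
      by_contra hle
      exact hv (Finset.mem_biUnion.2 ⟨c, hc, by simpa using hle⟩)
    have hvC : v ∉ C := fun hvC => by simpa using hfar v hvC
    have := hmax (insert v C) (by
      simp only [Finset.mem_filter, Finset.mem_univ, true_and, Finset.mem_insert]
      rintro c (rfl | hc) c' (rfl | hc') hne
      · exact absurd rfl hne
      · rw [hammingDist_comm]; exact hfar c' hc'
      · exact hfar c hc
      · exact hC' c hc c' hc' hne)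
    rw [Finset.card_insert_of_notMem hvC] at this
    omega
  have h1 := (Finset.card_le_card hcover).trans
    (Finset.card_biUnion_le_card_mul _ _ _ fun c _ => card_hammingDist_le w c)
  simp only [Finset.card_univ, Fintype.card_pi, Fintype.card_fin, Finset.prod_const] at h1
  have h2 : 16 ^ w = 4 ^ w * 4 ^ w := by rw [← mul_pow]; norm_num
  rw [h2] at h1
  exact Nat.le_of_mul_le_mul_right h1 (by positivity)

theorem exists_shatters_card {F : Set (X → Bool)} {d : ℕ} (hd : 1 ≤ d) (hF : vcDim F = d) :
    ∃ A : Finset X, Shatters F A ∧ A.card = d := by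
  by_contra hcon
  push Not at hcon
  have hle : vcDim F ≤ ((d - 1 : ℕ) : ℕ∞) := by
    refine iSup₂_le fun A hA => ?_
    have h1 : (A.card : ℕ∞) ≤ d := by rw [← hF]; exact le_iSup₂_of_le A hA le_rfl
    have h2 : A.card ≤ d := by exact_mod_cast h1
    have h3 := hcon A hA
    exact_mod_cast (by omega : A.card ≤ d - 1)
  rw [hF] at hle
  have : d ≤ d - 1 := by exact_mod_cast hle
  omega

theorem dim_div_le_gammaLoc {F : Set (X → Bool)} {n d : ℕ} {h : ℝ} (hd : 1 ≤ d)
    (hF : vcDim F = d) (hh : 0 < h) (hh1 : h ≤ 1) (hn : d < n * h ^ 2) :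
    d / h ≤ 64 * (gammaLoc F n h h : ℝ) := by
  classical
  have hinv := inv_le_two_mul_gammaLoc (F := F) (n := n) (h' := h) hh hh1
  have hγ0 : (0 : ℝ) ≤ gammaLoc F n h h := Nat.cast_nonneg _
  rcases le_or_gt d 16 with hd16 | hd16
  · have : (d : ℝ) ≤ 16 := by exact_mod_cast hd16
    calc d / h = d * (1 / h) := by ring
      _ ≤ 16 * (2 * gammaLoc F n h h) := by gcongr
      _ ≤ 64 * gammaLoc F n h h := by linarith
  obtain ⟨A, hA, hcard⟩ := exists_shatters_card hd hF
  set w := (d - 1) / 16 with hw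
  set k := ⌊1 / h⌋₊ with hk
  have hk1 : 1 ≤ k := Nat.le_floor (by rw [Nat.cast_one, le_div_iff₀ hh]; linarith)
  have hkh : (k : ℝ) ≤ 1 / h := Nat.floor_le (by positivity)
  have hkh1 : h * k ≤ 1 := by rwa [le_div_iff₀ hh, mul_comm] at hkh
  -- The shattered set holds `w` blocks of 16 points and one spare point for padding. A codeword
  -- selects one point in each block, so every resulting classifier is at distance `w` from the one
  -- labelled by the empty set.
  obtain ⟨e⟩ : Nonempty (Option (Fin w × Fin 16) ↪ A) :=
    Function.Embedding.nonempty_of_card_le (by simp [hcard]; omega)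
  obtain ⟨C, hCcard, hC⟩ := exists_code w
  have hlab : ∀ S : Finset (Fin w × Fin 16), ∃ f ∈ F, f (e none) = false ∧
      ∀ p, f (e (some p)) = decide (p ∈ S) := by
    intro S
    obtain ⟨f, hf, hfA⟩ := hA fun y => decide (∃ p ∈ S, (e (some p) : X) = y)
    refine ⟨f, hf, ?_, fun p => ?_⟩
    · rw [hfA _ (e none).2]
      simp only [decide_eq_false_iff_not, not_exists, not_and]
      intro p _ hp
      simpa using e.injective (Subtype.ext hp)
    · rw [hfA _ (e (some p)).2, decide_eq_decide]
      constructor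
      · rintro ⟨q, hq, hqp⟩
        have := e.injective (Subtype.ext hqp)
        simp only [Option.some.injEq] at this
        rwa [← this]
      · exact fun hp => ⟨p, hp, rfl⟩
  choose g hgF hgz hg using hlab
  let S : (Fin w → Fin 16) → Finset (Fin w × Fin 16) := fun c =>
    Finset.univ.filter fun p => c p.1 = p.2
  have : Nonempty C := by
    have : 0 < C.card := lt_of_lt_of_le (by positivity) hCcard
    exact (Finset.card_pos.1 this).to_subtype
  have hmain : k * w ≤ gammaLoc F n h h := by
    refine mul_le_gammaLoc (κ := C) (fun p => (e (some p) : X)) (e none) hk1 ?_ (hgF ∅)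
      (fun c => g (S c)) (fun c => hgF _) (fun c => by rw [hgz, hgz]) (fun c => ?_)
      (fun c c' hcc => ?_) hh hh1 ?_
    · have h1 : ((Fintype.card (Fin w × Fin 16) * k : ℕ) : ℝ) ≤ n := by
        have h16 : ((w * 16 : ℕ) : ℝ) ≤ d := by exact_mod_cast (by omega : w * 16 ≤ d)
        simp only [Fintype.card_prod, Fintype.card_fin]
        push_cast at h16 ⊢
        calc (w * 16 * k : ℝ) ≤ d * (1 / h) := by gcongr
          _ ≤ (n * h ^ 2) * (1 / h) := by gcongr
          _ = n * h := by field_simp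
          _ ≤ n * 1 := by gcongr
          _ = n := mul_one _
      exact_mod_cast h1
    · have : (Finset.univ.filter fun j => g ∅ (e (some j)) ≠ g (S c) (e (some j))) =
          Finset.univ.image fun i => (i, (c : Fin w → Fin 16) i) := by
        ext ⟨i, a⟩
        simp [hg, S]
      rw [this]
      exact Finset.card_image_le.trans (by simp)
    -- Each block where two codewords differ contributes both selected points, so distances are at
    -- least twice the Hamming distance of the codewords.
    · have hsub : ((Finset.univ.filter fun i => (c : Fin w → Fin 16) i ≠ (c' : Fin w → Fin 16) i)
          ×ˢ (Finset.univ : Finset Bool)).image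
            (fun p => (p.1, if p.2 then (c : Fin w → Fin 16) p.1 else (c' : Fin w → Fin 16) p.1))
          ⊆ Finset.univ.filter fun j => g (S c) (e (some j)) ≠ g (S c') (e (some j)) := by
        intro q hq
        obtain ⟨⟨i, b⟩, hp, rfl⟩ := Finset.mem_image.1 hq
        simp only [Finset.mem_product, Finset.mem_filter, Finset.mem_univ, true_and,
          and_true] at hp
        cases b <;> simp [hg, S, hp, Ne.symm hp]
      have hcard2 := Finset.card_le_card hsub
      rw [Finset.card_image_of_injOn, Finset.card_product] at hcard2
      · have h3 := hC c c.2 c' c'.2 (fun hcc' => hcc (Subtype.ext hcc'))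
        have h4 : hammingDist (c : Fin w → Fin 16) c' = (Finset.univ.filter fun i =>
          (c : Fin w → Fin 16) i ≠ (c' : Fin w → Fin 16) i).card := rfl
        rw [h4] at h3
        simp only [Finset.card_univ, Fintype.card_bool] at hcard2
        omega
      · rintro ⟨i, b⟩ hp ⟨i', b'⟩ hp' hpp
        simp only [Finset.coe_product, Set.mem_prod, Finset.mem_coe, Finset.mem_filter,
          Finset.mem_univ, true_and, and_true] at hp hp'
        simp only [Prod.mk.injEq] at hpp
        obtain ⟨rfl, h2⟩ := hpp
        cases b <;> cases b' <;> simp_all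
    · have h4 : (w : ℝ) ≤ Real.log (4 ^ w) := by
        rw [Real.log_pow]
        have : (1 : ℝ) ≤ Real.log 4 := by
          rw [Real.le_log_iff_exp_le (by norm_num)]
          linarith [Real.exp_one_lt_d9]
        nlinarith [Nat.cast_nonneg (α := ℝ) w]
      calc h * ((k * w : ℕ) : ℝ) = h * k * w := by push_cast; ring
        _ ≤ 1 * w := by gcongr
        _ = w := one_mul _
        _ ≤ Real.log (4 ^ w) := h4
        _ ≤ Real.log (Fintype.card C) := by
          refine Real.log_le_log (by positivity) ?_
          rw [Fintype.card_coe]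
          exact_mod_cast hCcard
  have hd32 : (d : ℝ) ≤ 32 * w := by exact_mod_cast (by omega : d ≤ 32 * w)
  have hk2 : 1 / h ≤ 2 * k := by
    have := Nat.lt_floor_add_one (1 / h)
    rw [← hk] at this
    have : (1 : ℝ) ≤ k := by exact_mod_cast hk1
    linarith
  have hmain' : (k : ℝ) * w ≤ gammaLoc F n h h := by exact_mod_cast hmain
  calc d / h = d * (1 / h) := by ring
    _ ≤ 32 * w * (2 * k) := by gcongr
    _ = 64 * (k * w) := by ring
    _ ≤ 64 * gammaLoc F n h h := by gcongr

theorem exists_hasStar_ge {F : Set (X → Bool)} {m : ℕ} (hm : 1 ≤ m) (hs : (m : ℕ∞) ≤ starNumber F) :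
    ∃ k, m ≤ k ∧ HasStar F k := by
  by_contra hcon
  push Not at hcon
  have hle : starNumber F ≤ ((m - 1 : ℕ) : ℕ∞) := by
    refine iSup₂_le fun k hk => ?_
    have : k < m := by
      by_contra hkm
      exact hcon k (not_lt.1 hkm) hk
    exact_mod_cast (by omega : k ≤ m - 1)
  have : m ≤ m - 1 := by exact_mod_cast hs.trans hle
  omega

theorem star_ne_iff {k : ℕ} {x : Fin k → X} {f₀ : X → Bool} {f : Fin k → X → Bool}
    (hx : Function.Injective x) (hf : ∀ i, DIS {f₀, f i} ∩ Set.range x = {x i}) (i j : Fin k) :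
    f₀ (x j) ≠ f i (x j) ↔ j = i := by
  have h1 : x j ∈ DIS {f₀, f i} ∩ Set.range x ↔ j = i := by
    rw [hf i, Set.mem_singleton_iff, hx.eq_iff]
  rw [← h1]
  simp only [DIS, Set.mem_inter_iff, Set.mem_ofPred_eq, Set.mem_insert_iff, Set.mem_singleton_iff,
    Set.mem_range_self, and_true]
  constructor
  · exact fun h => ⟨f₀, Or.inl rfl, f i, Or.inr rfl, h⟩
  · rintro ⟨a, rfl | rfl, b, rfl | rfl, hab⟩
    · exact absurd rfl hab
    · exact hab
    · exact hab.symm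
    · exact absurd rfl hab

/-- The leaves of a star are at distance 1 from the centre and differ pairwise, so `w = 1` and `k`
is about `log m / h`. The star point of index `m` serves as padding, whence the requirement of `m +
1` points. -/
theorem log_star_le_gammaLoc {F : Set (X → Bool)} {n m : ℕ} {h : ℝ} (hm : 2 ≤ m)
    (hs : ((m + 1 : ℕ) : ℕ∞) ≤ starNumber F) (hh : 0 < h) (hh1 : h ≤ 1)
    (hn : (m : ℝ) ^ 2 ≤ n * h ^ 2) :
    Real.log m / h ≤ 2 * (gammaLoc F n h h : ℝ) := by
  classical
  have hγ1 : (1 : ℝ) ≤ gammaLoc F n h h := by exact_mod_cast one_le_gammaLoc hh hh1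
  obtain ⟨K, hmK, x, f₀, f, hx, hf₀, hfF, hf⟩ := exists_hasStar_ge (by omega) hs
  set k := ⌊Real.log m / h⌋₊ with hk
  have hlog0 : 0 ≤ Real.log m := Real.log_nonneg (by exact_mod_cast (by omega : 1 ≤ m))
  have hkle : (k : ℝ) ≤ Real.log m / h := Nat.floor_le (by positivity)
  have hlt := Nat.lt_floor_add_one (Real.log m / h)
  rw [← hk] at hlt
  rcases Nat.eq_zero_or_pos k with hk0 | hk0
  · rw [hk0] at hlt
    push_cast at hlt
    linarith
  have hne := star_ne_iff hx hf
  let ι : Fin m → Fin K := fun i => ⟨i, by omega⟩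
  have hιinj : Function.Injective ι := fun a b hab => by
    simp only [ι, Fin.mk.injEq] at hab
    exact Fin.ext hab
  have : Nonempty (Fin m) := ⟨⟨0, by omega⟩⟩
  have hmain : k * 1 ≤ gammaLoc F n h h := by
    refine mul_le_gammaLoc (κ := Fin m) (fun i => x (ι i)) (x ⟨m, by omega⟩) hk0 ?_ hf₀
      (fun i => f (ι i)) (fun i => hfF _) (fun i => ?_) (fun i => ?_) (fun i j hij => ?_) hh hh1 ?_
    · have : ((Fintype.card (Fin m) * k : ℕ) : ℝ) ≤ n := by
        rw [Fintype.card_fin]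
        push_cast
        calc (m : ℝ) * k ≤ m * (Real.log m / h) := by gcongr
          _ ≤ m * (m / h) := by
            gcongr
            exact (Real.log_le_sub_one_of_pos (by exact_mod_cast (by omega : 0 < m))).trans
              (by linarith)
          _ = m ^ 2 / h := by ring
          _ ≤ n * h ^ 2 / h := by gcongr
          _ = n * h := by field_simp
          _ ≤ n * 1 := by gcongr
          _ = n := mul_one _
      exact_mod_cast this
    · by_contra hcon
      have := (hne (ι i) ⟨m, by omega⟩).1 (Ne.symm hcon)
      simp only [ι, Fin.mk.injEq] at this
      omega
    · have : (Finset.univ.filter fun j => f₀ (x (ι j)) ≠ f (ι i) (x (ι j))) = {i} := by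
        ext j
        simp only [Finset.mem_filter, Finset.mem_univ, true_and, Finset.mem_singleton, hne,
          hιinj.eq_iff]
      rw [this, Finset.card_singleton]
    · have : 0 < (Finset.univ.filter fun l => f (ι i) (x (ι l)) ≠ f (ι j) (x (ι l))).card := by
        refine Finset.card_pos.2 ⟨i, ?_⟩
        simp only [Finset.mem_filter, Finset.mem_univ, true_and]
        have h1 := (hne (ι i) (ι i)).2 rfl
        have h2 : f₀ (x (ι i)) = f (ι j) (x (ι i)) := by
          by_contra h3
          exact hij (hιinj ((hne (ι j) (ι i)).1 h3))
        rw [← h2]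
        exact h1.symm
      omega
    · rw [Fintype.card_fin, mul_one]
      rwa [le_div_iff₀ hh, mul_comm] at hkle
  have hmain' : (k : ℝ) ≤ gammaLoc F n h h := by
    rw [mul_one] at hmain; exact_mod_cast hmain
  linarith

theorem minENat_le_left (t : ℝ) (s : ℕ∞) : minENat t s ≤ t := by
  unfold minENat
  split_ifs
  · exact le_rfl
  · exact min_le_left _ _

theorem natCast_le_of_le_minENat {t : ℝ} {s : ℕ∞} {m : ℕ} (hm : (m : ℝ) ≤ minENat t s) :
    (m : ℕ∞) ≤ s := by
  unfold minENat at hm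
  split_ifs at hm with hs
  · rw [hs]; exact le_top
  · have h1 : m ≤ s.toNat := by exact_mod_cast hm.trans (min_le_right _ _)
    rw [← ENat.natCast_toNat hs]
    exact_mod_cast h1

theorem tlog_min_star_div_le_gammaLoc {F : Set (X → Bool)} {n : ℕ} {h : ℝ}
    (hh : 0 < h) (hh1 : h ≤ 1) :
    tlog (minENat (n * h ^ 2) (starNumber F)) / h ≤ 8 * (gammaLoc F n h h : ℝ) := by
  set T := minENat (n * h ^ 2) (starNumber F) with hT
  have hinv := inv_le_two_mul_gammaLoc (F := F) (n := n) (h' := h) hh hh1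
  have hγ0 : (0 : ℝ) ≤ gammaLoc F n h h := Nat.cast_nonneg _
  rcases lt_or_ge T 9 with hT9 | hT9
  · have : tlog T ≤ 4 := by
      refine tlog_le_of_le_exp (by norm_num) (hT9.le.trans ?_)
      have := Real.exp_one_gt_d9
      calc (9 : ℝ) ≤ 2 ^ 4 := by norm_num
        _ ≤ (Real.exp 1) ^ 4 := pow_le_pow_left₀ (by norm_num) (by linarith) 4
        _ = Real.exp 4 := by rw [← Real.exp_nat_mul]; norm_num
    calc tlog T / h = tlog T * (1 / h) := by ring
      _ ≤ 4 * (2 * gammaLoc F n h h) := by gcongr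
      _ = 8 * gammaLoc F n h h := by ring
  set q := ⌊Real.sqrt T⌋₊ with hq
  have hq3 : 3 ≤ q := Nat.le_floor (Real.le_sqrt_of_sq_le (by norm_num; exact hT9))
  have hqle : (q : ℝ) ≤ Real.sqrt T := Nat.floor_le (Real.sqrt_nonneg _)
  have hqlt : Real.sqrt T < q + 1 := Nat.lt_floor_add_one _
  have hq2 : (q : ℝ) ^ 2 ≤ T := by
    calc (q : ℝ) ^ 2 ≤ Real.sqrt T ^ 2 := by gcongr
      _ = T := Real.sq_sqrt (by linarith)
  have hq3' : (3 : ℝ) ≤ q := by exact_mod_cast hq3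
  -- With `q = m + 1` about the square root of `T`, both requirements `m + 1 ≤ s` and `m ^ 2 ≤ n * h
  -- ^ 2` hold. Since `m ≥ 2`, also `T ≤ (m + 2) ^ 2 ≤ m ^ 4`, so only a factor 4 is lost in the
  -- logarithm.
  obtain ⟨m, hm⟩ : ∃ m, q = m + 1 := ⟨q - 1, by omega⟩
  have hqm : (q : ℝ) = m + 1 := by rw [hm]; push_cast; ring
  have hm2 : (2 : ℝ) ≤ m := by linarith
  have key := log_star_le_gammaLoc (F := F) (n := n) (m := m) (by omega)
    (natCast_le_of_le_minENat (t := n * h ^ 2) (by rw [← hT, ← hm]; nlinarith)) hh hh1 (by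
      have : T ≤ n * h ^ 2 := minENat_le_left _ _
      nlinarith)
  have hTm : T ≤ (m : ℝ) ^ 4 := by
    have h1 : T ≤ (q + 1 : ℝ) ^ 2 := by
      rw [← Real.sq_sqrt (by linarith : 0 ≤ T)]
      gcongr
    have h2 : (q + 1 : ℝ) ≤ m ^ 2 := by rw [hqm]; nlinarith
    calc T ≤ (q + 1 : ℝ) ^ 2 := h1
      _ ≤ (m ^ 2) ^ 2 := by gcongr
      _ = m ^ 4 := by ring
  have hlogT : tlog T ≤ 4 * Real.log m := by
    have hTe : Real.exp 1 ≤ T := by linarith [Real.exp_one_lt_d9]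
    rw [tlog, max_eq_left hTe]
    calc Real.log T ≤ Real.log ((m : ℝ) ^ 4) := Real.log_le_log (by linarith) hTm
      _ = 4 * Real.log m := by rw [Real.log_pow]; norm_num
  calc tlog T / h ≤ 4 * Real.log m / h := by gcongr
    _ = 4 * (Real.log m / h) := by ring
    _ ≤ 4 * (2 * gammaLoc F n h h) := by gcongr
    _ = 8 * gammaLoc F n h h := by ring

end LowerBound

/-! ### Upper bound on the fixed point: Sauer–Shelah, subsampling and the star number -/

section UpperBound

theorem sum_choose_le_exp_pow {m d : ℕ} (hd : 1 ≤ d) (hdm : d ≤ m) :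
    ∑ k ∈ Finset.Iic d, (m.choose k : ℝ) ≤ (Real.exp 1 * m / d) ^ d := by
  have hd0 : (0 : ℝ) < d := by exact_mod_cast hd
  have hm0 : (0 : ℝ) < m := by exact_mod_cast hd.trans hdm
  have hdm' : (d : ℝ) ≤ m := by exact_mod_cast hdm
  have hq1 : (d : ℝ) / m ≤ 1 := (div_le_one hm0).2 hdm'
  have h1 : (∑ k ∈ Finset.Iic d, (m.choose k : ℝ)) * (d / m : ℝ) ^ d ≤ Real.exp 1 ^ d := by
    calc (∑ k ∈ Finset.Iic d, (m.choose k : ℝ)) * (d / m : ℝ) ^ d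
        = ∑ k ∈ Finset.Iic d, (m.choose k : ℝ) * (d / m : ℝ) ^ d := by rw [Finset.sum_mul]
      _ ≤ ∑ k ∈ Finset.Iic d, (m.choose k : ℝ) * (d / m : ℝ) ^ k := by
          refine Finset.sum_le_sum fun k hk => ?_
          gcongr ?_ * ?_
          exact pow_le_pow_of_le_one (by positivity) hq1 (Finset.mem_Iic.1 hk)
      _ ≤ ∑ k ∈ Finset.range (m + 1), (m.choose k : ℝ) * (d / m : ℝ) ^ k := by
          refine Finset.sum_le_sum_of_subset_of_nonneg (fun k hk => ?_) fun k _ _ => by positivity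
          rw [Finset.mem_range]
          have := Finset.mem_Iic.1 hk
          omega
      _ = (d / m + 1 : ℝ) ^ m := by
          rw [add_pow]
          exact Finset.sum_congr rfl fun k _ => by simp [mul_comm]
      _ ≤ Real.exp (d / m) ^ m := by
          gcongr
          exact Real.add_one_le_exp _
      _ = Real.exp 1 ^ d := by
          rw [← Real.exp_nat_mul, ← Real.exp_nat_mul]
          congr 1
          field_simp
  have h2 : (Real.exp 1 * m / d) ^ d = Real.exp 1 ^ d / (d / m : ℝ) ^ d := by
    rw [← div_pow]
    congr 1
    field_simp
  rw [h2, le_div_iff₀ (by positivity)]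
  exact h1

variable {X : Type*}

theorem card_le_of_injOn_sample {F : Set (X → Bool)} {d m : ℕ} (hd : 1 ≤ d) (hF : vcDim F = d)
    (hdm : d ≤ m) (y : Fin m → X) (G : Finset (X → Bool)) (hG : ∀ g ∈ G, g ∈ F)
    (hinj : ∀ g ∈ G, ∀ g' ∈ G, (∀ j, g (y j) = g' (y j)) → g = g') :
    (G.card : ℝ) ≤ (Real.exp 1 * m / d) ^ d := by
  classical
  set φ : (X → Bool) → Finset (Fin m) := fun g => Finset.univ.filter fun j => g (y j) = true
    with hφ
  have hφmem : ∀ g j, j ∈ φ g ↔ g (y j) = true := fun g j => by simp [hφ]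
  have hcard : (G.image φ).card = G.card := by
    refine Finset.card_image_of_injOn fun g hg g' hg' hgg => hinj g hg g' hg' fun j => ?_
    rw [Bool.eq_iff_iff, ← hφmem, ← hφmem, hgg]
  have hvc : (G.image φ).vcDim ≤ d := by
    refine Finset.sup_le fun s hs => ?_
    rw [Finset.mem_shatterer] at hs
    -- The sample may repeat points, but a shattered index set cannot: the trace `{j}` must separate
    -- `j` from every other index.
    have hyinj : Set.InjOn y s := by
      intro j hj j' hj' hjj
      by_contra hne
      obtain ⟨u, hu, hsu⟩ := hs (Finset.singleton_subset_iff.2 hj)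
      obtain ⟨g, -, rfl⟩ := Finset.mem_image.1 hu
      have h1 : j ∈ s ∩ φ g := by rw [hsu]; simp
      have h2 : j' ∈ s ∩ φ g := by
        refine Finset.mem_inter.2 ⟨hj', ?_⟩
        rw [hφmem, ← hjj, ← hφmem]
        exact (Finset.mem_inter.1 h1).2
      rw [hsu, Finset.mem_singleton] at h2
      exact hne h2.symm
    have hsh : Shatters F (s.image y) := by
      intro b
      obtain ⟨u, hu, hsu⟩ := hs (Finset.filter_subset (fun j => b (y j) = true) s)
      obtain ⟨g, hg, rfl⟩ := Finset.mem_image.1 hu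
      refine ⟨g, hG g hg, fun p hp => ?_⟩
      obtain ⟨j, hj, rfl⟩ := Finset.mem_image.1 hp
      have h1 : j ∈ s ∩ φ g ↔ j ∈ s.filter fun j => b (y j) = true := by rw [hsu]
      rw [Finset.mem_inter, hφmem, Finset.mem_filter] at h1
      rw [Bool.eq_iff_iff]
      tauto
    have h1 : ((s.image y).card : ℕ∞) ≤ d := by rw [← hF]; exact le_iSup₂_of_le _ hsh le_rfl
    rw [Finset.card_image_of_injOn hyinj] at h1
    exact_mod_cast h1
  have h1 := (Finset.card_le_card_shatterer (G.image φ)).trans Finset.card_shatterer_le_sum_vcDim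
  rw [hcard, Fintype.card_fin] at h1
  have h2 : (G.card : ℝ) ≤ ∑ k ∈ Finset.Iic (G.image φ).vcDim, (m.choose k : ℝ) := by
    exact_mod_cast h1
  refine h2.trans (le_trans ?_ (sum_choose_le_exp_pow hd hdm))
  exact Finset.sum_le_sum_of_subset_of_nonneg (Finset.Iic_subset_Iic.2 hvc)
    fun k _ _ => by positivity

/-- A random subsample separates a separated family. -/
theorem exists_separating_subsample {n m : ℕ} (x : Fin n → X) (D : Finset (Fin n))
    (G : Finset (X → Bool)) {δ : ℝ} (hG : 2 ≤ G.card)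
    (hD : ∀ g ∈ G, ∀ g' ∈ G, diff x g g' ⊆ D)
    (hsep : ∀ g ∈ G, ∀ g' ∈ G, g ≠ g' → δ < (diff x g g').card)
    (hm : 2 * Real.log G.card ≤ m * (δ / D.card)) (hD0 : 0 < D.card) :
    ∃ t : Fin m → Fin n, ∀ g ∈ G, ∀ g' ∈ G, (∀ j, g (x (t j)) = g' (x (t j))) → g = g' := by
  classical
  by_contra hcon
  push Not at hcon
  have hN : (0 : ℝ) < D.card := by exact_mod_cast hD0
  have hM : (0 : ℝ) < G.card := by exact_mod_cast (by omega : 0 < G.card)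
  -- If no subsample separates, every tuple from `D` avoids the difference set of some pair. For one
  -- pair the fraction of such tuples is at most `(1 - δ / |D|) ^ m ≤ |G| ^ (-2)`, and there are
  -- fewer than `|G| ^ 2` ordered pairs.
  have hsub : Fintype.piFinset (fun _ : Fin m => D) ⊆
      G.offDiag.biUnion fun p => Fintype.piFinset fun _ : Fin m => D \ diff x p.1 p.2 := by
    intro t ht
    obtain ⟨g, hg, g', hg', hgg, hne⟩ := hcon t
    refine Finset.mem_biUnion.2 ⟨(g, g'), by simp [Finset.mem_offDiag, hg, hg', hne], ?_⟩
    rw [Fintype.mem_piFinset] at ht ⊢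
    exact fun j => Finset.mem_sdiff.2 ⟨ht j, by simp [mem_diff, hgg j]⟩
  have h1 := (Finset.card_le_card hsub).trans Finset.card_biUnion_le
  simp only [Fintype.card_piFinset, Finset.prod_const, Finset.card_univ, Fintype.card_fin] at h1
  have h2 : (D.card : ℝ) ^ m ≤ ∑ p ∈ G.offDiag, ((D \ diff x p.1 p.2).card : ℝ) ^ m := by
    exact_mod_cast h1
  have h3 : ∀ p ∈ G.offDiag, ((D \ diff x p.1 p.2).card : ℝ) ^ m
      ≤ (D.card : ℝ) ^ m / (G.card : ℝ) ^ 2 := by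
    intro p hp
    obtain ⟨hp1, hp2, hp3⟩ := Finset.mem_offDiag.1 hp
    have hcard : ((D \ diff x p.1 p.2).card : ℝ) = D.card - (diff x p.1 p.2).card := by
      rw [Finset.card_sdiff_of_subset (hD _ hp1 _ hp2),
        Nat.cast_sub (Finset.card_le_card (hD _ hp1 _ hp2))]
    have hle : ((D \ diff x p.1 p.2).card : ℝ) ≤ D.card * Real.exp (-(δ / D.card)) := by
      have := Real.add_one_le_exp (-(δ / D.card))
      have h5 := hsep _ hp1 _ hp2 hp3
      calc ((D \ diff x p.1 p.2).card : ℝ) ≤ D.card - δ := by rw [hcard]; linarith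
        _ = D.card * (-(δ / D.card) + 1) := by field_simp; ring
        _ ≤ _ := by gcongr
    calc ((D \ diff x p.1 p.2).card : ℝ) ^ m ≤ (D.card * Real.exp (-(δ / D.card))) ^ m := by
          gcongr
      _ = D.card ^ m * Real.exp (-(m * (δ / D.card))) := by
          rw [mul_pow, ← Real.exp_nat_mul]
          congr 2
          ring
      _ ≤ D.card ^ m * Real.exp (-(2 * Real.log G.card)) := by gcongr
      _ = (D.card : ℝ) ^ m / (G.card : ℝ) ^ 2 := by
          rw [Real.exp_neg, div_eq_mul_inv]
          congr 2
          have : 2 * Real.log G.card = Real.log ((G.card : ℝ) ^ 2) := by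
            rw [Real.log_pow]; norm_num
          rw [this, Real.exp_log (by positivity)]
  have h4 := h2.trans (Finset.sum_le_sum h3)
  rw [Finset.sum_const, nsmul_eq_mul] at h4
  have h5 : (G.offDiag.card : ℝ) < (G.card : ℝ) ^ 2 := by
    have : G.offDiag.card < G.card ^ 2 := by
      rw [Finset.offDiag_card, sq]
      have : 0 < G.card * G.card := by positivity
      omega
    exact_mod_cast this
  have h6 : (G.offDiag.card : ℝ) * ((D.card : ℝ) ^ m / (G.card : ℝ) ^ 2) < (D.card : ℝ) ^ m := by
    calc (G.offDiag.card : ℝ) * ((D.card : ℝ) ^ m / (G.card : ℝ) ^ 2)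
        < (G.card : ℝ) ^ 2 * ((D.card : ℝ) ^ m / (G.card : ℝ) ^ 2) := by gcongr
      _ = (D.card : ℝ) ^ m := by field_simp
  linarith

/-- Subsampling about `2 * a * L` indices, where `a = |D| / δ` and `L = log |G|`, and applying
Sauer–Shelah bounds `L / d` by `log (3 * e * a) + log (L / d)`. The last term is at most `L / (2 *
d)` and is absorbed on the left. -/
theorem log_card_le_of_separated {F : Set (X → Bool)} {d n : ℕ} (hd : 1 ≤ d) (hF : vcDim F = d)
    (x : Fin n → X) (D : Finset (Fin n)) (G : Finset (X → Bool)) {δ : ℝ} (hδ : 0 < δ)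
    (hG : ∀ g ∈ G, g ∈ F) (hD : ∀ g ∈ G, ∀ g' ∈ G, diff x g g' ⊆ D)
    (hsep : ∀ g ∈ G, ∀ g' ∈ G, g ≠ g' → δ < (diff x g g').card) :
    Real.log G.card ≤ 2 * d * tlog (3 * Real.exp 1 * (D.card / δ)) := by
  set L := Real.log G.card with hL
  set a : ℝ := D.card / δ with ha
  by_contra! hcon
  have hd0 : (1 : ℝ) ≤ d := by exact_mod_cast hd
  have htl := one_le_tlog (3 * Real.exp 1 * a)
  have hLd : (d : ℝ) ≤ L := by nlinarith
  have hG2 : 2 ≤ G.card := by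
    by_contra hlt
    have : L ≤ 0 := by
      refine Real.log_nonpos (by positivity) ?_
      exact_mod_cast (by omega : G.card ≤ 1)
    linarith
  obtain ⟨g, hg, g', hg', hne⟩ := Finset.one_lt_card.1 hG2
  have hDδ : δ < D.card := (hsep g hg g' hg' hne).trans_le (by
    exact_mod_cast Finset.card_le_card (hD g hg g' hg'))
  have hN : (0 : ℝ) < D.card := hδ.trans hDδ
  have ha1 : 1 ≤ a := by rw [ha, le_div_iff₀ hδ]; linarith
  set m := ⌈2 * a * L⌉₊ with hm
  have hmge : 2 * a * L ≤ m := Nat.le_ceil _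
  have hL0 : 0 < L := by linarith
  have hmle : (m : ℝ) ≤ 3 * a * L := by
    have := Nat.ceil_lt_add_one (by positivity : 0 ≤ 2 * a * L)
    rw [← hm] at this
    nlinarith
  have hdm : d ≤ m := by
    have : (d : ℝ) ≤ m := by nlinarith
    exact_mod_cast this
  obtain ⟨t, ht⟩ := exists_separating_subsample (m := m) x D G hG2 hD hsep (by
    rw [← hL]
    have h1 : δ / D.card = 1 / a := by rw [ha, one_div_div]
    rw [h1, mul_one_div, le_div_iff₀ (by linarith)]
    linarith) (by exact_mod_cast hN)
  have h1 := card_le_of_injOn_sample hd hF hdm (fun j => x (t j)) G hG ht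
  have hM : (0 : ℝ) < G.card := by exact_mod_cast (by omega : 0 < G.card)
  have h2 : L ≤ d * Real.log (Real.exp 1 * m / d) := by
    rw [← Real.log_pow]
    exact Real.log_le_log hM h1
  have hu : 0 < L / d := by positivity
  have h3 : Real.log (Real.exp 1 * m / d) ≤ Real.log (3 * Real.exp 1 * a) + Real.log (L / d) := by
    rw [← Real.log_mul (by positivity) (by positivity)]
    have hm0 : (0 : ℝ) < m := by
      have : (d : ℝ) ≤ m := by exact_mod_cast hdm
      linarith
    refine Real.log_le_log (by positivity) ?_
    calc Real.exp 1 * m / d ≤ Real.exp 1 * (3 * a * L) / d := by gcongr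
      _ = 3 * Real.exp 1 * a * (L / d) := by ring
  have h4 : Real.log (L / d) ≤ L / d / 2 := by
    have h5 := Real.log_le_sub_one_of_pos (half_pos hu)
    rw [Real.log_div hu.ne' two_ne_zero] at h5
    linarith [Real.log_two_lt_d9]
  have h5 : Real.log (3 * Real.exp 1 * a) ≤ tlog (3 * Real.exp 1 * a) :=
    log_le_tlog (by positivity)
  have h6 : L / d ≤ tlog (3 * Real.exp 1 * a) + L / d / 2 := by
    rw [div_le_iff₀ (by linarith), mul_comm]
    refine h2.trans ?_
    gcongr
    linarith
  have h7 : L / d ≤ 2 * tlog (3 * Real.exp 1 * a) := by linarith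
  rw [div_le_iff₀ (by linarith)] at h7
  linarith

theorem card_biUnion_diff_le_star {F : Set (X → Bool)} {n : ℕ} (x : Fin n → X) {f : X → Bool}
    (hf : f ∈ F) (G : Finset (X → Bool)) (hG : ∀ g ∈ G, g ∈ F) {r : ℝ}
    (hr : ∀ g ∈ G, ((diff x f g).card : ℝ) ≤ r) (hs : starNumber F ≠ ⊤) (hr0 : 0 ≤ r) :
    ((G.biUnion fun g => diff x f g).card : ℝ) ≤ (starNumber F).toNat * r := by
  classical
  obtain ⟨G', hG', hmin⟩ := Finset.exists_min_image
    (G.powerset.filter fun G' => (G'.biUnion fun g => diff x f g) = G.biUnion fun g => diff x f g)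
    Finset.card ⟨G, by simp⟩
  obtain ⟨hG'G, hG'U⟩ := Finset.mem_filter.1 hG'
  rw [Finset.mem_powerset] at hG'G
  -- By minimality each member of `G'` has an index covered by no other member. These private
  -- indices are the points of a star centred at `f`.
  have hpriv : ∀ g : G', ∃ i, i ∈ diff x f g ∧ ∀ g' ∈ G', i ∈ diff x f g' → g' = g := by
    rintro ⟨g, hg⟩
    by_contra hcon
    push Not at hcon
    have := hmin (G'.erase g) (by
      refine Finset.mem_filter.2 ⟨Finset.mem_powerset.2 ((Finset.erase_subset _ _).trans hG'G), ?_⟩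
      rw [← hG'U]
      refine Finset.Subset.antisymm
        (Finset.biUnion_subset_biUnion_of_subset_left _ (Finset.erase_subset _ _)) fun i hi => ?_
      obtain ⟨g', hg', hig'⟩ := Finset.mem_biUnion.1 hi
      by_cases hgg : g' = g
      · obtain ⟨g₂, hg₂, hi₂, hne⟩ := hcon i (hgg ▸ hig')
        exact Finset.mem_biUnion.2 ⟨g₂, Finset.mem_erase.2 ⟨hne, hg₂⟩, hi₂⟩
      · exact Finset.mem_biUnion.2 ⟨g', Finset.mem_erase.2 ⟨hgg, hg'⟩, hig'⟩)
    rw [Finset.card_erase_of_mem hg] at this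
    have := Finset.card_pos.2 ⟨g, hg⟩
    omega
  choose u hu hpriv using hpriv
  have hne : ∀ g g' : G', f (x (u g)) ≠ (g' : X → Bool) (x (u g)) → g' = g :=
    fun g g' hfg => Subtype.ext (hpriv g g' g'.2 (mem_diff.2 hfg))
  let e := G'.equivFin.symm
  have hstar : HasStar F G'.card := by
    refine ⟨fun i => x (u (e i)), f, fun i => e i, ?_, hf, fun i => hG _ (hG'G (e i).2), fun i => ?_⟩
    · intro i j hij
      simp only at hij
      have h1 := mem_diff.1 (hu (e j))
      rw [← hij] at h1
      exact (e.injective (hne (e i) (e j) h1)).symm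
    · have hmem : ∀ p, p ∈ DIS {f, (e i : X → Bool)} ↔ f p ≠ (e i : X → Bool) p := by
        intro p
        simp only [DIS, Set.mem_ofPred_eq, Set.mem_insert_iff, Set.mem_singleton_iff]
        constructor
        · rintro ⟨a, rfl | rfl, b, rfl | rfl, hab⟩
          · exact absurd rfl hab
          · exact hab
          · exact hab.symm
          · exact absurd rfl hab
        · exact fun h => ⟨f, Or.inl rfl, _, Or.inr rfl, h⟩
      ext p
      rw [Set.mem_inter_iff, hmem, Set.mem_singleton_iff]
      constructor
      · rintro ⟨hp, j, rfl⟩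
        have := hne (e j) (e i) hp
        rw [e.injective this]
      · rintro rfl
        exact ⟨mem_diff.1 (hu (e i)), i, rfl⟩
  have hk : (G'.card : ℕ∞) ≤ starNumber F := le_iSup₂_of_le _ hstar le_rfl
  have hk' : G'.card ≤ (starNumber F).toNat := by simpa using ENat.toNat_le_toNat hk hs
  rw [← hG'U]
  calc ((G'.biUnion fun g => diff x f g).card : ℝ) ≤ ∑ g ∈ G', ((diff x f g).card : ℝ) := by
        exact_mod_cast Finset.card_biUnion_le
    _ ≤ ∑ g ∈ G', r := Finset.sum_le_sum fun g hg => hr g (hG'G hg)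
    _ = G'.card * r := by simp
    _ ≤ (starNumber F).toNat * r := by gcongr

theorem le_minENat {y t : ℝ} {s : ℕ∞} (ht : y ≤ t) (hs : s ≠ ⊤ → y ≤ s.toNat) :
    y ≤ minENat t s := by
  unfold minENat
  split_ifs with h
  · exact ht
  · exact le_min ht (hs h)

theorem gammaLoc_le {F : Set (X → Bool)} {n d : ℕ} {h : ℝ} (hd : 1 ≤ d) (hF : vcDim F = d)
    (hh : 0 < h) :
    (gammaLoc F n h h : ℝ) ≤ 8 * (d * tlog (minENat (n * h ^ 2 / d) (starNumber F)) / h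
      + d * tlog (1 / h) / h) := by
  classical
  set T := minENat (n * h ^ 2 / d) (starNumber F) with hT
  set γ := gammaLoc F n h h with hγ
  have h1 := one_le_tlog T
  have h2 := one_le_tlog (1 / h)
  have hd0 : (1 : ℝ) ≤ d := by exact_mod_cast hd
  have hrw : 8 * (d * tlog T / h + d * tlog (1 / h) / h)
      = 8 * d * (tlog T + tlog (1 / h)) / h := by ring
  rw [hrw, le_div_iff₀ hh]
  set E := 8 * d * (tlog T + tlog (1 / h)) with hE
  have hE1 : d ≤ E := by
    have : (1 : ℝ) ≤ 8 * (tlog T + tlog (1 / h)) := by linarith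
    rw [hE]
    nlinarith
  -- Below `d / h` the claim is immediate. Otherwise every scale satisfies `ε ≥ d / h`, which turns
  -- the trivial bound `|D| ≤ n` into `|D| * h / ε ≤ n * h ^ 2 / d`.
  rcases lt_or_ge (γ : ℝ) (d / h) with hlt | hge
  · rw [lt_div_iff₀ hh] at hlt
    linarith
  have hM : ((locPacking F γ n h).toNat : ℝ) ≤ Real.exp E := by
    refine le_trans ?_ (Nat.floor_le (Real.exp_pos E).le)
    rw [Nat.cast_le]
    refine locPacking_toNat_le _ fun x f ε G hf hγε hG hball hsep => Nat.le_floor ?_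
    rcases G.eq_empty_or_nonempty with rfl | hne
    · simpa using (Real.exp_pos E).le
    have hε : 0 < ε := lt_of_lt_of_le (lt_of_lt_of_le (by positivity) hge) hγε
    set D := G.biUnion fun g => diff x f g with hDdef
    have hlog := log_card_le_of_separated hd hF x D G (half_pos hε) hG (fun g hg g' hg' i hi => by
      rw [mem_diff] at hi
      by_cases hfg : f (x i) = g (x i)
      · exact Finset.mem_biUnion.2 ⟨g', hg', mem_diff.2 (by rw [hfg]; exact hi)⟩
      · exact Finset.mem_biUnion.2 ⟨g, hg, mem_diff.2 hfg⟩) hsep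
    have hDn : (D.card : ℝ) ≤ n := by
      exact_mod_cast (Finset.card_le_univ D).trans_eq (Fintype.card_fin n)
    have hDT : D.card / ε * h ≤ T := by
      refine le_minENat ?_ fun hs => ?_
      · have hdε : d / h ≤ ε := hge.trans hγε
        calc D.card / ε * h ≤ n / (d / h) * h := by gcongr
          _ = n * h ^ 2 / d := by field_simp
      · have := card_biUnion_diff_le_star x hf G hG hball hs (by positivity)
        rw [← hDdef] at this
        calc D.card / ε * h ≤ (starNumber F).toNat * (ε / h) / ε * h := by gcongr
          _ = (starNumber F).toNat := by field_simp
    have htl : tlog (3 * Real.exp 1 * (D.card / (ε / 2))) ≤ 3 + tlog T + tlog (1 / h) := by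
      refine tlog_le_of_le_exp (by linarith) ?_
      rw [Real.exp_add, Real.exp_add]
      have hT' := le_exp_tlog T
      have hh' := le_exp_tlog (1 / h)
      have he3 : 6 * Real.exp 1 ≤ Real.exp 3 := by
        have he := Real.exp_one_gt_d9
        have : Real.exp 3 = Real.exp 1 * (Real.exp 1 * Real.exp 1) := by
          rw [← Real.exp_add, ← Real.exp_add]; norm_num
        rw [this]
        nlinarith [Real.exp_pos 1]
      calc 3 * Real.exp 1 * (D.card / (ε / 2)) = 6 * Real.exp 1 * (D.card / ε * h) * (1 / h) := by
            field_simp; ring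
        _ ≤ Real.exp 3 * Real.exp (tlog T) * Real.exp (tlog (1 / h)) := by
            have : D.card / ε * h ≤ Real.exp (tlog T) := hDT.trans hT'
            gcongr
    have hlE : Real.log G.card ≤ E := by
      refine hlog.trans ?_
      calc 2 * d * tlog (3 * Real.exp 1 * (D.card / (ε / 2)))
          ≤ 2 * d * (3 + tlog T + tlog (1 / h)) := by gcongr
        _ ≤ 2 * d * (4 * (tlog T + tlog (1 / h))) := by gcongr; linarith
        _ = E := by rw [hE]; ring
    rwa [Real.log_le_iff_le_exp (by exact_mod_cast hne.card_pos)] at hlE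
  have := (gammaLoc_spec (F := F) (n := n) (h' := h) hh).trans
    (tlog_le_of_le_exp (hd0.trans hE1) hM)
  rw [mul_comm]
  exact this

end UpperBound

/-! ### Exponential moments of sign processes with negative drift -/

section OffsetSum

variable {X : Type*}

/-- Each halving of the scale costs one factor of the local packing number. The cells of radius `ε /
2` lie in balls of radius `ε / 2 / h` because `h ≤ 1`, so they can be covered again, and the scale
never falls below `γ`. -/
theorem exists_refined_cover {F : Set (X → Bool)} {γ n : ℕ} {h : ℝ} (hh : 0 < h) (hh1 : h ≤ 1)
    (x : Fin n → X) (j : ℕ) : ∀ {ε : ℝ} {f : X → Bool}, f ∈ F → γ * 2 ^ j ≤ ε →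
    ∃ G : Finset (X → Bool), (∀ g ∈ G, g ∈ F) ∧
      G.card ≤ (locPacking F γ n h).toNat ^ (j + 1) ∧
      ∀ g ∈ F, ((diff x f g).card : ℝ) ≤ ε / h →
        ∃ g' ∈ G, ((diff x g g').card : ℝ) ≤ ε / 2 ^ (j + 1) := by
  classical
  induction j with
  | zero =>
    intro ε f hf hε
    simpa using exists_cover (h := h) x hf (by simpa using hε)
  | succ j ih =>
    intro ε f hf hε
    have hpow : (γ : ℝ) * 2 ^ j ≤ ε / 2 := by
      rw [pow_succ] at hε; linarith
    have hγ0 : (0 : ℝ) ≤ γ * 2 ^ j := by positivity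
    have hγε : (γ : ℝ) ≤ ε := by
      have : (1 : ℝ) ≤ 2 ^ (j + 1) := one_le_pow₀ (by norm_num)
      nlinarith [Nat.cast_nonneg (α := ℝ) γ]
    obtain ⟨G, hGF, hGcard, hG⟩ := exists_cover (h := h) x hf hγε
    have hex : ∀ g : G, ∃ G' : Finset (X → Bool), (∀ g' ∈ G', g' ∈ F) ∧
        G'.card ≤ (locPacking F γ n h).toNat ^ (j + 1) ∧
        ∀ g' ∈ F, ((diff x (g : X → Bool) g').card : ℝ) ≤ ε / 2 / h →
          ∃ g'' ∈ G', ((diff x g' g'').card : ℝ) ≤ ε / 2 / 2 ^ (j + 1) :=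
      fun g => ih (hGF g g.2) hpow
    choose C hCF hCcard hC using hex
    refine ⟨G.attach.biUnion C, ?_, ?_, ?_⟩
    · intro g hg
      obtain ⟨g', -, hg'⟩ := Finset.mem_biUnion.1 hg
      exact hCF g' g hg'
    · calc (G.attach.biUnion C).card ≤ G.attach.card * (locPacking F γ n h).toNat ^ (j + 1) :=
            Finset.card_biUnion_le_card_mul _ _ _ fun g _ => hCcard g
        _ ≤ (locPacking F γ n h).toNat * (locPacking F γ n h).toNat ^ (j + 1) := by
            rw [Finset.card_attach]; gcongr
        _ = _ := by rw [pow_succ' _ (j + 1)]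
    · intro g hg hfg
      obtain ⟨g₁, hg₁, hgg₁⟩ := hG g hg hfg
      obtain ⟨g₂, hg₂, hgg₂⟩ := hC ⟨g₁, hg₁⟩ g hg (by
        rw [diff_comm]
        refine hgg₁.trans ?_
        rw [le_div_iff₀ hh]
        nlinarith)
      refine ⟨g₂, Finset.mem_biUnion.2 ⟨⟨g₁, hg₁⟩, Finset.mem_attach _ _, hg₂⟩, ?_⟩
      refine hgg₂.trans_eq ?_
      rw [pow_succ _ (j + 1)]
      field_simp

/-- The offset sign process `∑ (eᵢ aᵢ - h / 2)`, the sum running over the disagreement set. -/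
def offset {n : ℕ} (h : ℝ) (a : Fin n → ℝ) (e : Fin n → Bool) (D : Finset (Fin n)) : ℝ :=
  ∑ i ∈ D, (label (e i) * a i - h / 2)

theorem abs_label (b : Bool) : |label b| = 1 := by cases b <;> simp [label]

/-- Subgaussianity of the signs costs `θ ^ 2 * a ^ 2 / 2` per index, at most half of the drift `θ *
h / 2` for the admitted `θ`. The other half survives. -/
theorem sum_exp_offset_le {n : ℕ} {h θ : ℝ} (hθ0 : 0 ≤ θ) (hθ : θ * (25 / 8) ≤ h / 4)
    {a : Fin n → ℝ} (ha : ∀ i, |a i| ≤ 5 / 2) (D : Finset (Fin n)) :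
    ∑ e : Fin n → Bool, Real.exp (θ * offset h a e D)
      ≤ 2 ^ n * Real.exp (-(θ * h / 4 * D.card)) := by
  classical
  have hfac : ∀ e : Fin n → Bool, Real.exp (θ * offset h a e D) =
      ∏ i, (if i ∈ D then Real.exp (θ * (label (e i) * a i - h / 2)) else 1) := by
    intro e
    rw [offset, Finset.mul_sum, Real.exp_sum, Finset.prod_ite_mem, Finset.univ_inter]
  have hswap := Finset.prod_univ_sum (fun _ : Fin n => (Finset.univ : Finset Bool))
    (fun i b => if i ∈ D then Real.exp (θ * (label b * a i - h / 2)) else 1)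
  rw [Fintype.piFinset_univ] at hswap
  simp_rw [hfac]
  rw [← hswap]
  have hi : ∀ i : Fin n, ∑ b : Bool, (if i ∈ D then Real.exp (θ * (label b * a i - h / 2)) else 1)
      ≤ 2 * (if i ∈ D then Real.exp (-(θ * h / 4)) else 1) := by
    intro i
    by_cases hiD : i ∈ D
    · simp only [hiD, if_true, Fintype.sum_bool, label, Bool.false_eq_true, if_false]
      have h1 : Real.exp (θ * (1 * a i - h / 2)) + Real.exp (θ * (-1 * a i - h / 2))
          = 2 * (Real.cosh (θ * a i) * Real.exp (-(θ * h / 2))) := by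
        rw [Real.cosh_eq, show θ * (1 * a i - h / 2) = θ * a i + -(θ * h / 2) by ring,
          show θ * (-1 * a i - h / 2) = -(θ * a i) + -(θ * h / 2) by ring, Real.exp_add,
          Real.exp_add]
        ring
      rw [h1]
      have h2 := Real.cosh_le_exp_half_sq (θ * a i)
      have h3 : (θ * a i) ^ 2 / 2 ≤ θ * h / 4 := by
        have h4 : a i ^ 2 ≤ (5 / 2) ^ 2 := sq_le_sq' (by linarith [(abs_le.1 (ha i)).1])
          (abs_le.1 (ha i)).2
        calc (θ * a i) ^ 2 / 2 = θ * (θ * (a i ^ 2 / 2)) := by ring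
          _ ≤ θ * (θ * ((5 / 2) ^ 2 / 2)) := by gcongr
          _ = θ * (θ * (25 / 8)) := by norm_num
          _ ≤ θ * (h / 4) := by gcongr
          _ = θ * h / 4 := by ring
      gcongr
      calc Real.cosh (θ * a i) * Real.exp (-(θ * h / 2))
          ≤ Real.exp (θ * h / 4) * Real.exp (-(θ * h / 2)) := by
            gcongr
            exact h2.trans (Real.exp_le_exp.2 h3)
        _ = Real.exp (-(θ * h / 4)) := by rw [← Real.exp_add]; congr 1; ring
    · simp [hiD]
  refine (Finset.prod_le_prod (fun i _ => Finset.sum_nonneg fun b _ => ?_)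
    fun i _ => hi i).trans_eq ?_
  · split_ifs <;> positivity
  · rw [Finset.prod_mul_distrib, Finset.prod_const, Finset.card_univ, Fintype.card_fin,
      Finset.prod_ite_mem, Finset.univ_inter, Finset.prod_const, ← Real.exp_nat_mul]
    congr 2
    ring

/-- A changed index alters the sum by at most `5 / 2 + h / 2 ≤ 3`. -/
theorem offset_diff_le {n : ℕ} {h : ℝ} (hh : 0 < h) (hh1 : h ≤ 1) {a : Fin n → ℝ}
    (ha : ∀ i, |a i| ≤ 5 / 2) (e : Fin n → Bool) (x : Fin n → X) (f₀ f g : X → Bool) :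
    offset h a e (diff x f₀ f) ≤ offset h a e (diff x f₀ g) + 3 * (diff x f g).card := by
  classical
  have hsum : ∀ D : Finset (Fin n), offset h a e D =
      ∑ i, if i ∈ D then (label (e i) * a i - h / 2) else 0 := fun D => by
    rw [offset, Finset.sum_ite_mem, Finset.univ_inter]
  have hcard : 3 * ((diff x f g).card : ℝ) = ∑ i, if i ∈ diff x f g then (3 : ℝ) else 0 := by
    rw [Finset.sum_ite_mem, Finset.univ_inter, Finset.sum_const, nsmul_eq_mul, mul_comm]
  rw [hsum, hsum, hcard, ← Finset.sum_add_distrib]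
  refine Finset.sum_le_sum fun i _ => ?_
  have hb : |label (e i) * a i| ≤ 5 / 2 := by rw [abs_mul, abs_label, one_mul]; exact ha i
  obtain ⟨hb1, hb2⟩ := abs_le.1 hb
  simp only [mem_diff]
  cases f₀ (x i) <;> cases f (x i) <;> cases g (x i) <;> simp <;> linarith

/-- Averaged over the signs, the exponential of the supremum over the class of the offset sign
process is at most `exp (14 h γ)`. -/
theorem exists_exp_offset_bound {F : Set (X → Bool)} {n γ : ℕ} {h : ℝ} (hh : 0 < h) (hh1 : h ≤ 1)
    (hγ : tlog ((locPacking F γ n h).toNat : ℝ) ≤ h * γ) (x : Fin n → X) {f₀ : X → Bool}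
    (hf₀ : f₀ ∈ F) {a : Fin n → ℝ} (ha : ∀ i, |a i| ≤ 5 / 2) :
    ∃ B : (Fin n → Bool) → ℝ,
      (∀ e, ∀ f ∈ F, Real.exp (h / 16 * offset h a e (diff x f₀ f)) ≤ B e) ∧
      ∑ e, B e ≤ 2 ^ n * Real.exp (14 * (h * γ)) := by
  classical
  have hγ1 : 1 ≤ h * γ := (one_le_tlog _).trans hγ
  have hγ0 : (1 : ℝ) ≤ γ := by nlinarith [Nat.cast_nonneg (α := ℝ) γ]
  -- Shell `k` has radius `ε k / h` and is covered at scale `ε k / 2 ^ 7`. The factor 4096 makes `h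
  -- / 16 * ε k = 256 * 2 ^ k * (h * γ)`.
  set ε : ℕ → ℝ := fun k => 2 ^ k * (4096 * γ) with hε
  have hε0 : ∀ k, 0 < ε k := fun k => by simp only [hε]; positivity
  have hcov : ∀ k, ∃ G : Finset (X → Bool), (∀ g ∈ G, g ∈ F) ∧
      G.card ≤ (locPacking F γ n h).toNat ^ 7 ∧
      ∀ g ∈ F, ((diff x f₀ g).card : ℝ) ≤ ε k / h →
        ∃ g' ∈ G, ((diff x g g').card : ℝ) ≤ ε k / 2 ^ 7 := by
    intro k
    refine exists_refined_cover hh hh1 x 6 hf₀ ?_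
    have : (1 : ℝ) ≤ 2 ^ k := one_le_pow₀ (by norm_num)
    simp only [hε]
    nlinarith
  choose C hCF hCcard hC using hcov
  -- Only centres far from `f₀` are kept when `k > 0`. A classifier outside the previous ball is at
  -- distance above `ε k / (2 * h)`, and its centre loses at most `ε k / 128`, so it still lies
  -- beyond `ε k / (4 * h)`.
  set C' : ℕ → Finset (X → Bool) := fun k =>
    (C k).filter fun c => k = 0 ∨ ε k / h / 4 ≤ (diff x f₀ c).card with hC'
  have hCcard' : ∀ k, ((C' k).card : ℝ) ≤ Real.exp (7 * (h * γ)) := by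
    intro k
    have h1 : ((C' k).card : ℝ) ≤ ((locPacking F γ n h).toNat : ℝ) ^ 7 := by
      exact_mod_cast (Finset.card_filter_le _ _).trans (hCcard k)
    have h2 : ((locPacking F γ n h).toNat : ℝ) ≤ Real.exp (h * γ) :=
      (le_exp_tlog _).trans (Real.exp_le_exp.2 hγ)
    calc ((C' k).card : ℝ) ≤ Real.exp (h * γ) ^ 7 := h1.trans (by gcongr)
      _ = Real.exp (7 * (h * γ)) := by rw [← Real.exp_nat_mul]; norm_num
  refine ⟨fun e => ∑ k ∈ Finset.range (n + 1), ∑ c ∈ C' k,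
    Real.exp (h / 16 * (3 * (ε k / 2 ^ 7))) * Real.exp (h / 16 * offset h a e (diff x f₀ c)),
    fun e f hf => ?_, ?_⟩
  · have hex : ∃ k, ((diff x f₀ f).card : ℝ) ≤ ε k / h ∧ k ≤ n := by
      refine ⟨n, ?_, le_rfl⟩
      have h1 : ((diff x f₀ f).card : ℝ) ≤ n := by
        exact_mod_cast (Finset.card_le_univ _).trans_eq (Fintype.card_fin n)
      have h2 : (n : ℝ) ≤ 2 ^ n := by exact_mod_cast Nat.lt_two_pow_self.le
      rw [le_div_iff₀ hh]
      simp only [hε]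
      have h3 : (2 : ℝ) ^ n * 1 ≤ 2 ^ n * (4096 * γ) := by gcongr; linarith
      nlinarith [Nat.cast_nonneg (α := ℝ) (diff x f₀ f).card]
    obtain ⟨hk, hkn⟩ := Nat.find_spec hex
    have hmin := fun m => Nat.find_min hex (m := m)
    set k := Nat.find hex with hkdef
    obtain ⟨c, hc, hfc⟩ := hC k f hf hk
    have hc' : c ∈ C' k := by
      refine Finset.mem_filter.2 ⟨hc, ?_⟩
      rcases Nat.eq_zero_or_pos k with h0 | hpos
      · exact Or.inl h0
      · right
        have h1 := hmin (k - 1) (by omega)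
        have h2 : ε (k - 1) / h < (diff x f₀ f).card := by
          by_contra hle
          exact h1 ⟨not_lt.1 hle, by omega⟩
        have h3 : ε k = 2 * ε (k - 1) := by
          simp only [hε]
          obtain ⟨j, hj⟩ : ∃ j, k = j + 1 := ⟨k - 1, by omega⟩
          rw [hj, Nat.add_sub_cancel, pow_succ]
          ring
        have h4 := card_diff_triangle x f₀ c f
        rw [diff_comm x c f] at h4
        have h5 : ε k ≤ ε k / h := by rw [le_div_iff₀ hh]; nlinarith [hε0 k]
        have h6 : ε (k - 1) / h = ε k / h / 2 := by rw [h3]; ring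
        norm_num at hfc
        have := hε0 k
        linarith
    have hsingle : Real.exp (h / 16 * offset h a e (diff x f₀ f)) ≤
        Real.exp (h / 16 * (3 * (ε k / 2 ^ 7)))
          * Real.exp (h / 16 * offset h a e (diff x f₀ c)) := by
      rw [← Real.exp_add, Real.exp_le_exp, ← mul_add]
      have := offset_diff_le hh hh1 ha e x f₀ f c
      gcongr
      linarith
    refine hsingle.trans (le_trans ?_ (Finset.single_le_sum
      (f := fun k => ∑ c ∈ C' k, Real.exp (h / 16 * (3 * (ε k / 2 ^ 7)))
        * Real.exp (h / 16 * offset h a e (diff x f₀ c)))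
      (fun k _ => Finset.sum_nonneg fun c _ => by positivity)
      (Finset.mem_range.2 (Nat.lt_succ_of_le hkn))))
    exact Finset.single_le_sum (f := fun c => Real.exp (h / 16 * (3 * (ε k / 2 ^ 7)))
        * Real.exp (h / 16 * offset h a e (diff x f₀ c))) (fun c _ => by positivity) hc'
  · rw [Finset.sum_comm]
    have hk : ∀ k ∈ Finset.range (n + 1), ∑ e : Fin n → Bool, ∑ c ∈ C' k,
        Real.exp (h / 16 * (3 * (ε k / 2 ^ 7))) * Real.exp (h / 16 * offset h a e (diff x f₀ c))
        ≤ 2 ^ n * Real.exp (13 * (h * γ)) * (1 / 2) ^ k := by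
      intro k _
      rw [Finset.sum_comm]
      set b : ℝ := if k = 0 then 0 else h / 16 * (ε k / 16) with hb
      have hc : ∀ c ∈ C' k, ∑ e : Fin n → Bool, Real.exp (h / 16 * (3 * (ε k / 2 ^ 7)))
          * Real.exp (h / 16 * offset h a e (diff x f₀ c))
          ≤ Real.exp (h / 16 * (3 * (ε k / 2 ^ 7))) * (2 ^ n * Real.exp (-b)) := by
        intro c hc
        rw [← Finset.mul_sum]
        gcongr
        refine (sum_exp_offset_le (by positivity) (by linarith) ha _).trans ?_
        gcongr
        rw [hb]
        split_ifs with hk0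
        · positivity
        · have h1 := ((Finset.mem_filter.1 hc).2).resolve_left hk0
          calc h / 16 * (ε k / 16) = h / 16 * h / 4 * (ε k / h / 4) := by field_simp; ring
            _ ≤ h / 16 * h / 4 * (diff x f₀ c).card := by gcongr
      refine (Finset.sum_le_sum hc).trans ?_
      rw [Finset.sum_const, nsmul_eq_mul]
      have hhalf : Real.exp (-(k : ℝ)) ≤ (1 / 2) ^ k := by
        have h1 : Real.exp (-(k : ℝ)) = Real.exp (-1) ^ k := by
          rw [← Real.exp_nat_mul]; congr 1; ring
        rw [h1]
        gcongr
        rw [Real.exp_neg, one_div]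
        gcongr
        linarith [Real.exp_one_gt_d9]
      -- For `k = 0` there is no drift, and the approximation costs `3 / 128 * 256 = 6`, giving `7 +
      -- 6 = 13`. For `k > 0` the drift `1 / 16` beats the approximation cost `3 / 128` by `5 /
      -- 128`, that is, by `10 * 2 ^ k * (h * γ)`.
      have hexp : 7 * (h * γ) + h / 16 * (3 * (ε k / 2 ^ 7)) - b ≤ 13 * (h * γ) - k := by
        have hεk : h / 16 * ε k = 256 * 2 ^ k * (h * γ) := by simp only [hε]; ring
        rw [hb]
        split_ifs with hk0
        · rw [hk0] at hεk ⊢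
          norm_num at hεk ⊢
          linarith
        · have hk2 : (k : ℝ) ≤ 2 ^ k := by exact_mod_cast Nat.lt_two_pow_self.le
          have h1 : h / 16 * (3 * (ε k / 2 ^ 7)) - h / 16 * (ε k / 16)
              = -(10 * 2 ^ k * (h * γ)) := by
            calc h / 16 * (3 * (ε k / 2 ^ 7)) - h / 16 * (ε k / 16)
                = -(5 / 128) * (h / 16 * ε k) := by ring
              _ = _ := by rw [hεk]; ring
          have h2 : (k : ℝ) ≤ 2 ^ k * (h * γ) := by nlinarith [Nat.cast_nonneg (α := ℝ) k]
          have h3 : 0 ≤ 2 ^ k * (h * γ) := by positivity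
          linarith
      calc ((C' k).card : ℝ) * (Real.exp (h / 16 * (3 * (ε k / 2 ^ 7))) * (2 ^ n * Real.exp (-b)))
          ≤ Real.exp (7 * (h * γ))
            * (Real.exp (h / 16 * (3 * (ε k / 2 ^ 7))) * (2 ^ n * Real.exp (-b))) := by
            gcongr
            exact hCcard' k
        _ = 2 ^ n * Real.exp (7 * (h * γ) + h / 16 * (3 * (ε k / 2 ^ 7)) - b) := by
            rw [sub_eq_add_neg, Real.exp_add, Real.exp_add]; ring
        _ ≤ 2 ^ n * Real.exp (13 * (h * γ) - k) := by gcongr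
        _ = 2 ^ n * Real.exp (13 * (h * γ)) * Real.exp (-(k : ℝ)) := by
            rw [sub_eq_add_neg, Real.exp_add]; ring
        _ ≤ 2 ^ n * Real.exp (13 * (h * γ)) * (1 / 2) ^ k := by gcongr
    refine (Finset.sum_le_sum hk).trans ?_
    rw [← Finset.mul_sum]
    have hgeom : ∑ k ∈ Finset.range (n + 1), (1 / 2 : ℝ) ^ k ≤ 2 := by
      have := Summable.sum_le_tsum (f := fun k : ℕ => (1 / 2 : ℝ) ^ k) (Finset.range (n + 1))
        (fun k _ => by positivity) summable_geometric_two
      rwa [tsum_geometric_two] at this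
    calc 2 ^ n * Real.exp (13 * (h * γ)) * ∑ k ∈ Finset.range (n + 1), (1 / 2 : ℝ) ^ k
        ≤ 2 ^ n * Real.exp (13 * (h * γ)) * Real.exp (h * γ) := by
          gcongr
          refine hgeom.trans (le_trans ?_ (Real.exp_le_exp.2 hγ1))
          linarith [Real.exp_one_gt_d9]
      _ = 2 ^ n * Real.exp (14 * (h * γ)) := by
          rw [mul_assoc, ← Real.exp_add]; congr 2; ring

end OffsetSum

/-! ### Ghost sample, random exchange, and measurability of the supremum -/

section Symmetrization

variable {X : Type*}

/-- The zero-one loss. -/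
def loss (f : X → Bool) (z : X × Bool) : ℝ := if f z.1 ≠ z.2 then 1 else 0

/-- The indicator of the disagreement of two classifiers, as a function on `X × Bool`. -/
def disagree (f₀ f : X → Bool) (z : X × Bool) : ℝ := if f₀ z.1 ≠ f z.1 then 1 else 0

/-- The excess loss. -/
def excess (f₀ f : X → Bool) (z : X × Bool) : ℝ := loss f z - loss f₀ z

/-- The two-sample process dominating the excess risk of empirical risk minimizers. -/
def ghostSum {n : ℕ} (h : ℝ) (f₀ f : X → Bool)
    (p : (Fin n → X × Bool) × (Fin n → X × Bool)) : ℝ :=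
  ∑ i, (2 * excess f₀ f (p.2 i) - h * disagree f₀ f (p.2 i) - 2 * excess f₀ f (p.1 i))

theorem abs_excess_le (f₀ f : X → Bool) (z : X × Bool) : |excess f₀ f z| ≤ 1 := by
  unfold excess loss
  split_ifs <;> norm_num

theorem disagree_nonneg (f₀ f : X → Bool) (z : X × Bool) : 0 ≤ disagree f₀ f z := by
  unfold disagree
  split_ifs <;> norm_num

theorem disagree_le_one (f₀ f : X → Bool) (z : X × Bool) : disagree f₀ f z ≤ 1 := by
  unfold disagree
  split_ifs <;> norm_num

theorem abs_disagree_le (f₀ f : X → Bool) (z : X × Bool) : |disagree f₀ f z| ≤ 1 := by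
  rw [abs_of_nonneg (disagree_nonneg f₀ f z)]
  exact disagree_le_one f₀ f z

theorem excess_eq_label_mul (f₀ f : X → Bool) (z : X × Bool) :
    excess f₀ f z = label (decide (f₀ z.1 = z.2)) * disagree f₀ f z := by
  unfold excess loss disagree label
  cases f z.1 <;> cases f₀ z.1 <;> cases z.2 <;> simp

theorem disagree_eq_label_mul (f₀ f : X → Bool) (z : X × Bool) :
    disagree f₀ f z = label (decide (f₀ z.1 = z.2)) * loss f z + loss f₀ z := by
  unfold loss disagree label
  cases f z.1 <;> cases f₀ z.1 <;> cases z.2 <;> simp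

theorem ghostSum_le {n : ℕ} {h : ℝ} (hh : 0 < h) (f₀ f : X → Bool)
    (p : (Fin n → X × Bool) × (Fin n → X × Bool)) : ghostSum h f₀ f p ≤ 4 * n := by
  calc ghostSum h f₀ f p ≤ ∑ _i : Fin n, (4 : ℝ) := by
        refine Finset.sum_le_sum fun i _ => ?_
        have h1 := abs_le.1 (abs_excess_le f₀ f (p.1 i))
        have h2 := abs_le.1 (abs_excess_le f₀ f (p.2 i))
        have h3 := mul_nonneg hh.le (disagree_nonneg f₀ f (p.2 i))
        linarith
    _ = 4 * n := by simp [mul_comm]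

/-- Without boundedness the real supremum would take its default value 0 and would not dominate the
individual sums. -/
theorem bddAbove_ghostSum {n : ℕ} {h : ℝ} (hh : 0 < h) (F : Set (X → Bool)) (f₀ : X → Bool)
    (p : (Fin n → X × Bool) × (Fin n → X × Bool)) :
    BddAbove (Set.range fun f : F => ghostSum h f₀ f p) :=
  ⟨4 * n, by rintro _ ⟨f, rfl⟩; exact ghostSum_le hh f₀ f p⟩

/-- Exchange the two samples at the indices `i` with `e i = false`. -/
def swapSamples {n : ℕ} {Z : Type*} (e : Fin n → Bool) (p : (Fin n → Z) × (Fin n → Z)) :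
    (Fin n → Z) × (Fin n → Z) :=
  (fun i => if e i then p.1 i else p.2 i, fun i => if e i then p.2 i else p.1 i)

theorem offset_diff_eq_sum {n : ℕ} {h : ℝ} (a : Fin n → ℝ) (e : Fin n → Bool) (f₀ f : X → Bool)
    (z : Fin n → X × Bool) :
    offset h a e (diff (fun i => (z i).1) f₀ f)
      = ∑ i, (label (e i) * a i - h / 2) * disagree f₀ f (z i) := by
  rw [offset, diff, Finset.sum_filter]
  refine Finset.sum_congr rfl fun i _ => ?_
  unfold disagree
  split_ifs <;> simp

/-- An exchange moves `-h * disagree` from one sample to the other. Writing it as a sign part `∓ h /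
2` plus a constant `-h / 2` gives each sample its own drift, with coefficients bounded by `5 / 2`.
-/
theorem ghostSum_swapSamples {n : ℕ} {h : ℝ} (f₀ f : X → Bool) (e : Fin n → Bool)
    (p : (Fin n → X × Bool) × (Fin n → X × Bool)) :
    ghostSum h f₀ f (swapSamples e p) =
      offset h (fun i => 2 * label (decide (f₀ (p.2 i).1 = (p.2 i).2)) - h / 2) e
        (diff (fun i => (p.2 i).1) f₀ f) +
      offset h (fun i => 2 * label (decide (f₀ (p.1 i).1 = (p.1 i).2)) - h / 2)
        (fun i => !e i) (diff (fun i => (p.1 i).1) f₀ f) := by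
  rw [offset_diff_eq_sum, offset_diff_eq_sum, ← Finset.sum_add_distrib]
  refine Finset.sum_congr rfl fun i _ => ?_
  simp only [swapSamples, excess_eq_label_mul]
  cases e i <;> simp only [label, if_true, if_false, Bool.not_true, Bool.not_false,
    Bool.false_eq_true] <;> ring

/-- The average over all swaps of the exponential of the two-sample supremum. -/
theorem sum_exp_iSup_ghostSum_le {F : Set (X → Bool)} {n γ : ℕ} {h : ℝ} (hh : 0 < h)
    (hh1 : h ≤ 1) (hγ : tlog ((locPacking F γ n h).toNat : ℝ) ≤ h * γ) {f₀ : X → Bool}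
    (hf₀ : f₀ ∈ F) (p : (Fin n → X × Bool) × (Fin n → X × Bool)) :
    ∑ e, Real.exp (h / 32 * ⨆ f : F, ghostSum h f₀ f (swapSamples e p))
      ≤ 2 ^ n * Real.exp (14 * (h * γ)) := by
  have ha : ∀ (z : Fin n → X × Bool) (i : Fin n),
      |2 * label (decide (f₀ (z i).1 = (z i).2)) - h / 2| ≤ 5 / 2 := by
    intro z i
    rw [abs_le]
    cases decide (f₀ (z i).1 = (z i).2) <;> simp only [label, if_true, if_false,
      Bool.false_eq_true] <;> constructor <;> linarith
  obtain ⟨B₂, hB₂, hs₂⟩ := exists_exp_offset_bound hh hh1 hγ (fun i => (p.2 i).1) hf₀ (ha p.2)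
  obtain ⟨B₁, hB₁, hs₁⟩ := exists_exp_offset_bound hh hh1 hγ (fun i => (p.1 i).1) hf₀ (ha p.1)
  have : Nonempty F := ⟨⟨f₀, hf₀⟩⟩
  have hpt : ∀ e : Fin n → Bool,
      Real.exp (h / 32 * ⨆ f : F, ghostSum h f₀ f (swapSamples e p))
        ≤ (B₂ e + B₁ fun i => !e i) / 2 := by
    intro e
    have hpos : 0 < (B₂ e + B₁ fun i => !e i) / 2 := by
      have h1 := (Real.exp_pos _).trans_le (hB₂ e f₀ hf₀)
      have h2 := (Real.exp_pos _).trans_le (hB₁ (fun i => !e i) f₀ hf₀)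
      positivity
    rw [← Real.le_log_iff_exp_le hpos, mul_comm, ← le_div_iff₀ (by positivity)]
    refine ciSup_le fun f => ?_
    rw [le_div_iff₀ (by positivity), mul_comm, Real.le_log_iff_exp_le hpos,
      ghostSum_swapSamples]
    refine le_trans ?_ (div_le_div_of_nonneg_right
      (add_le_add (hB₂ e f f.2) (hB₁ (fun i => !e i) f f.2)) two_pos.le)
    -- The two processes share their signs and are not independent. Convexity separates them, at the
    -- price of halving `h / 16` to `h / 32`.
    have hconv : ∀ u v : ℝ, Real.exp (h / 32 * (u + v))
        ≤ (Real.exp (h / 16 * u) + Real.exp (h / 16 * v)) / 2 := by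
      intro u v
      have h1 : Real.exp (h / 32 * (u + v)) = Real.exp (h / 32 * u) * Real.exp (h / 32 * v) := by
        rw [← Real.exp_add]; congr 1; ring
      have h2 : ∀ u : ℝ, Real.exp (h / 16 * u) = Real.exp (h / 32 * u) ^ 2 := fun u => by
        rw [← Real.exp_nat_mul]; congr 1; push_cast; ring
      rw [h1, h2, h2]
      nlinarith [sq_nonneg (Real.exp (h / 32 * u) - Real.exp (h / 32 * v))]
    exact hconv _ _
  have hnot : ∑ e : Fin n → Bool, B₁ (fun i => !e i) = ∑ e, B₁ e :=
    Function.Bijective.sum_comp (e := fun (e : Fin n → Bool) i => !e i)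
      (Function.Involutive.bijective fun e => by simp) B₁
  calc ∑ e, Real.exp (h / 32 * ⨆ f : F, ghostSum h f₀ f (swapSamples e p))
      ≤ ∑ e : Fin n → Bool, (B₂ e + B₁ fun i => !e i) / 2 := Finset.sum_le_sum fun e _ => hpt e
    _ = (∑ e, B₂ e + ∑ e, B₁ e) / 2 := by
        rw [← Finset.sum_div, Finset.sum_add_distrib, hnot]
    _ ≤ _ := by linarith

theorem sum_excess_nonpos {F : Set (X → Bool)} {n : ℕ} (hn : 1 ≤ n)
    {A : (Fin n → X × Bool) → X → Bool} (hA : IsERM F A) {f₀ : X → Bool} (hf₀ : f₀ ∈ F)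
    (z : Fin n → X × Bool) : ∑ i, excess f₀ (A z) (z i) ≤ 0 := by
  have hn0 : (0 : ℝ) < n := by exact_mod_cast hn
  have h1 := (hA z).2 f₀ hf₀
  unfold empRisk at h1
  rw [div_le_div_iff_of_pos_right hn0] at h1
  unfold excess loss
  rw [Finset.sum_sub_distrib]
  linarith

variable [MeasurableSpace X]

theorem measurable_loss {f : X → Bool} (hf : Measurable f) : Measurable (loss f) :=
  (Measurable.of_discrete (f := fun q : Bool × Bool => if q.1 ≠ q.2 then (1 : ℝ) else 0)).comp
    ((hf.comp measurable_fst).prodMk measurable_snd)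

theorem measurable_disagree {f₀ f : X → Bool} (hf₀ : Measurable f₀) (hf : Measurable f) :
    Measurable (disagree f₀ f) :=
  (Measurable.of_discrete (f := fun q : Bool × Bool => if q.1 ≠ q.2 then (1 : ℝ) else 0)).comp
    ((hf₀.comp measurable_fst).prodMk (hf.comp measurable_fst))

theorem measurable_excess {f₀ f : X → Bool} (hf₀ : Measurable f₀) (hf : Measurable f) :
    Measurable (excess f₀ f) :=
  (measurable_loss hf).sub (measurable_loss hf₀)

/-- A pair of samples is a sample of pairs, on which the exchange acts coordinatewise by the
identity or by `Prod.swap`. -/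
theorem measurePreserving_swapSamples {Z : Type*} [MeasurableSpace Z] (P : Measure Z)
    [IsProbabilityMeasure P] {n : ℕ} (e : Fin n → Bool) :
    MeasurePreserving (swapSamples e)
      ((Measure.pi fun _ : Fin n => P).prod (Measure.pi fun _ : Fin n => P))
      ((Measure.pi fun _ : Fin n => P).prod (Measure.pi fun _ : Fin n => P)) := by
  have hE := measurePreserving_arrowProdEquivProdArrow Z Z (Fin n) (fun _ => P) (fun _ => P)
  have hmid : MeasurePreserving
      (fun (q : Fin n → Z × Z) i => (if e i then id else Prod.swap) (q i))
      (Measure.pi fun _ : Fin n => P.prod P) (Measure.pi fun _ : Fin n => P.prod P) := by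
    refine measurePreserving_pi (fun _ => P.prod P) (fun _ => P.prod P)
      (f := fun i => if e i then id else Prod.swap) fun i => ?_
    split_ifs
    · exact MeasurePreserving.id _
    · exact Measure.measurePreserving_swap
  have hcomp := (hE.comp hmid).comp (hE.symm)
  convert hcomp using 1
  funext p
  ext i <;> cases hi : e i <;>
    simp [swapSamples, MeasurableEquiv.arrowProdEquivProdArrow, Equiv.arrowProdEquivProdArrow, hi]

theorem measurePreserving_append {Z : Type*} [MeasurableSpace Z] (P : Measure Z)
    [IsProbabilityMeasure P] (n : ℕ) :
    MeasurePreserving (fun p : (Fin n → Z) × (Fin n → Z) => Fin.append p.1 p.2)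
      ((Measure.pi fun _ : Fin n => P).prod (Measure.pi fun _ : Fin n => P))
      (Measure.pi fun _ : Fin (n + n) => P) := by
  have h1 := measurePreserving_sumPiEquivProdPi_symm (X := fun _ : Fin n ⊕ Fin n => Z)
    (fun _ => P)
  have h2 := measurePreserving_piCongrLeft (fun _ : Fin (n + n) => P) (finSumFinEquiv (m := n))
  convert h2.comp h1 using 1
  funext p
  funext j
  obtain ⟨i, rfl⟩ := finSumFinEquiv.surjective j
  simp only [Function.comp_apply]
  rw [MeasurableEquiv.piCongrLeft_apply_apply]
  cases i
  · rw [finSumFinEquiv_apply_left, Fin.append_left]; rfl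
  · rw [finSumFinEquiv_apply_right, Fin.append_right]; rfl

theorem aemeasurable_iSup_weighted {P : Measure (X × Bool)} [IsProbabilityMeasure P]
    {F : Set (X → Bool)} (hP : IsMeasurableClass P F) {n : ℕ} (w w' : Fin n → ℝ) :
    AEMeasurable (fun p : (Fin n → X × Bool) × (Fin n → X × Bool) =>
      ⨆ f : F, ((∑ i, w i * loss f (p.1 i)) + ∑ i, w' i * loss f (p.2 i)))
      ((sampleLaw P n).prod (sampleLaw P n)) := by
  have h1 := (hP (n + n) (Fin.append w w'))
  have h2 := measurePreserving_append P n
  rw [sampleLaw, ← h2.map_eq] at h1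
  have h3 := h1.comp_measurable h2.measurable
  refine h3.congr (Filter.Eventually.of_forall fun p => ?_)
  simp only [Function.comp_apply, Fin.sum_univ_add, Fin.append_left, Fin.append_right]
  rfl

theorem aemeasurable_iSup_ghostSum {P : Measure (X × Bool)} [IsProbabilityMeasure P]
    {F : Set (X → Bool)} (hP : IsMeasurableClass P F) {n : ℕ} {h : ℝ} (hh : 0 < h)
    {f₀ : X → Bool} (hf₀ : f₀ ∈ F) (hf₀m : Measurable f₀) :
    AEMeasurable (fun p : (Fin n → X × Bool) × (Fin n → X × Bool) =>
      ⨆ f : F, ghostSum h f₀ f p) ((sampleLaw P n).prod (sampleLaw P n)) := by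
  classical
  have : Nonempty F := ⟨⟨f₀, hf₀⟩⟩
  -- The disagreement is affine in the loss of `f`, with a coefficient depending on whether `f₀`
  -- errs. On each of the finitely many error patterns of `f₀` the weights are constants, and
  -- measurability of the class applies to a sample of size `n + n`.
  set pat : (Fin n → X × Bool) × (Fin n → X × Bool) → Fin n → Bool :=
    fun p i => decide (f₀ (p.2 i).1 = (p.2 i).2) with hpat
  have hpatm : Measurable pat := by
    refine measurable_pi_iff.2 fun i => ?_
    exact (Measurable.of_discrete (f := fun q : Bool × Bool => decide (q.1 = q.2))).comp
      ((hf₀m.comp (measurable_fst.comp ((measurable_pi_apply i).comp measurable_snd))).prodMk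
        (measurable_snd.comp ((measurable_pi_apply i).comp measurable_snd)))
  set c : (Fin n → X × Bool) × (Fin n → X × Bool) → ℝ := fun p =>
    ∑ i, (2 * loss f₀ (p.1 i) - (2 + h) * loss f₀ (p.2 i)) with hc
  have hcm : Measurable c := by
    refine Finset.measurable_sum _ fun i _ => ?_
    exact (((measurable_loss hf₀m).comp ((measurable_pi_apply i).comp measurable_fst)).const_mul
      2).sub (((measurable_loss hf₀m).comp ((measurable_pi_apply i).comp measurable_snd)).const_mul
      (2 + h))
  set U : (Fin n → Bool) → (Fin n → X × Bool) × (Fin n → X × Bool) → ℝ := fun q p =>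
    ⨆ f : F, ((∑ i, (-2) * loss f (p.1 i)) + ∑ i, (2 - h * label (q i)) * loss f (p.2 i)) with hU
  have hUm : ∀ q, AEMeasurable (U q) ((sampleLaw P n).prod (sampleLaw P n)) := fun q =>
    aemeasurable_iSup_weighted hP (fun _ => -2) fun i => 2 - h * label (q i)
  have hdecomp : ∀ (f : X → Bool) p, ghostSum h f₀ f p =
      ((∑ i, (-2) * loss f (p.1 i)) + ∑ i, (2 - h * label (pat p i)) * loss f (p.2 i)) + c p := by
    intro f p
    simp only [ghostSum, hc, hpat]
    rw [← Finset.sum_add_distrib, ← Finset.sum_add_distrib]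
    refine Finset.sum_congr rfl fun i _ => ?_
    rw [disagree_eq_label_mul]
    unfold excess
    ring
  have heq : (fun p => ⨆ f : F, ghostSum h f₀ f p) =
      fun p => (∑ q, (pat ⁻¹' {q}).indicator (U q) p) + c p := by
    funext p
    have h1 : ∑ q, (pat ⁻¹' {q}).indicator (U q) p = U (pat p) p := by
      rw [Finset.sum_eq_single (pat p)]
      · simp
      · intro q _ hq
        exact Set.indicator_of_notMem (by simpa using Ne.symm hq) _
      · simp
    rw [h1, hU, ciSup_add]
    · exact iSup_congr fun f => hdecomp f p
    · obtain ⟨M, hM⟩ := bddAbove_ghostSum hh F f₀ p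
      refine ⟨M - c p, ?_⟩
      rintro _ ⟨f, rfl⟩
      have := hM ⟨f, rfl⟩
      simp only [hdecomp] at this
      simp only
      linarith
  rw [heq]
  refine AEMeasurable.add ?_ hcm.aemeasurable
  refine Finset.aemeasurable_fun_sum _ fun q _ => ?_
  exact (hUm q).indicator (hpatm (measurableSet_singleton q))

theorem lintegral_exp_iSup_ghostSum_le {P : Measure (X × Bool)} [IsProbabilityMeasure P]
    {F : Set (X → Bool)} (hP : IsMeasurableClass P F) {n γ : ℕ} {h : ℝ} (hh : 0 < h)
    (hh1 : h ≤ 1) (hγ : tlog ((locPacking F γ n h).toNat : ℝ) ≤ h * γ) {f₀ : X → Bool}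
    (hf₀ : f₀ ∈ F) (hf₀m : Measurable f₀) :
    ∫⁻ p, ENNReal.ofReal (Real.exp (h / 32 * ⨆ f : F, ghostSum h f₀ f p))
        ∂((sampleLaw P n).prod (sampleLaw P n))
      ≤ ENNReal.ofReal (Real.exp (14 * (h * γ))) := by
  set μ := (sampleLaw P n).prod (sampleLaw P n) with hμ
  set Φ : (Fin n → X × Bool) × (Fin n → X × Bool) → ℝ≥0∞ := fun p =>
    ENNReal.ofReal (Real.exp (h / 32 * ⨆ f : F, ghostSum h f₀ f p)) with hΦ
  have hΦm : AEMeasurable Φ μ :=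
    (Real.measurable_exp.comp_aemeasurable
      ((aemeasurable_iSup_ghostSum hP hh hf₀ hf₀m).const_mul _)).ennreal_ofReal
  have hswap : ∀ e : Fin n → Bool, MeasurePreserving (swapSamples e) μ μ := fun e =>
    measurePreserving_swapSamples P e
  have hΦe : ∀ e : Fin n → Bool, AEMeasurable (fun p => Φ (swapSamples e p)) μ := fun e => by
    have h1 : AEMeasurable Φ (μ.map (swapSamples e)) := by rw [(hswap e).map_eq]; exact hΦm
    exact h1.comp_measurable (hswap e).measurable
  have heq : ∀ e : Fin n → Bool, ∫⁻ p, Φ (swapSamples e p) ∂μ = ∫⁻ p, Φ p ∂μ := fun e => by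
    have h1 : AEMeasurable Φ (μ.map (swapSamples e)) := by rw [(hswap e).map_eq]; exact hΦm
    rw [← lintegral_map' h1 (hswap e).measurable.aemeasurable, (hswap e).map_eq]
  have hsum : (2 : ℝ≥0∞) ^ n * ∫⁻ p, Φ p ∂μ = ∫⁻ p, ∑ e, Φ (swapSamples e p) ∂μ := by
    rw [lintegral_finsetSum' _ fun e _ => hΦe e]
    simp [heq]
  have hle : ∫⁻ p, ∑ e, Φ (swapSamples e p) ∂μ
      ≤ 2 ^ n * ENNReal.ofReal (Real.exp (14 * (h * γ))) := by
    calc ∫⁻ p, ∑ e, Φ (swapSamples e p) ∂μ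
        ≤ ∫⁻ _, 2 ^ n * ENNReal.ofReal (Real.exp (14 * (h * γ))) ∂μ := by
          refine lintegral_mono fun p => ?_
          simp only [hΦ]
          rw [← ENNReal.ofReal_sum_of_nonneg fun e _ => (Real.exp_pos _).le]
          refine (ENNReal.ofReal_le_ofReal
            (sum_exp_iSup_ghostSum_le hh hh1 hγ hf₀ p)).trans_eq ?_
          rw [ENNReal.ofReal_mul (by positivity), ENNReal.ofReal_pow (by norm_num)]
          simp
      _ = 2 ^ n * ENNReal.ofReal (Real.exp (14 * (h * γ))) := by simp [hμ]
  rw [← hsum] at hle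
  exact (ENNReal.mul_le_mul_iff_right (by positivity) (by simp)).1 hle

end Symmetrization

/-! ### From the exponential moment to the risk of an ERM -/

section ERM

variable {X : Type*} [MeasurableSpace X]

theorem integrable_of_abs_le {Ω : Type*} [MeasurableSpace Ω] {μ : Measure Ω} [IsFiniteMeasure μ]
    {f : Ω → ℝ} (hf : Measurable f) {C : ℝ} (hC : ∀ ω, |f ω| ≤ C) : Integrable f μ :=
  Integrable.of_bound hf.aestronglyMeasurable C (Filter.Eventually.of_forall hC)

theorem integrable_loss (P : Measure (X × Bool)) [IsProbabilityMeasure P] {f : X → Bool}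
    (hf : Measurable f) : Integrable (loss f) P :=
  integrable_of_abs_le (measurable_loss hf) (C := 1) fun z => by
    unfold loss; split_ifs <;> norm_num

theorem integrable_excess (P : Measure (X × Bool)) [IsProbabilityMeasure P] {f₀ f : X → Bool}
    (hf₀ : Measurable f₀) (hf : Measurable f) : Integrable (excess f₀ f) P :=
  integrable_of_abs_le (measurable_excess hf₀ hf) (abs_excess_le f₀ f)

theorem integrable_disagree (P : Measure (X × Bool)) [IsProbabilityMeasure P] {f₀ f : X → Bool}
    (hf₀ : Measurable f₀) (hf : Measurable f) : Integrable (disagree f₀ f) P :=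
  integrable_of_abs_le (measurable_disagree hf₀ hf) (abs_disagree_le f₀ f)

theorem integral_loss (P : Measure (X × Bool)) [IsProbabilityMeasure P] {f : X → Bool}
    (hf : Measurable f) : ∫ z, loss f z ∂P = risk P f := by
  have hs : MeasurableSet {z : X × Bool | f z.1 ≠ z.2} := by
    have := measurable_loss hf (measurableSet_singleton (1 : ℝ))
    convert this using 1
    ext z
    simp [loss]
  have : loss f = Set.indicator {z : X × Bool | f z.1 ≠ z.2} fun _ => (1 : ℝ) := by
    funext z
    simp [loss, Set.indicator]
  rw [this, integral_indicator_const _ hs]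
  simp [risk]

theorem risk_congr {P : Measure (X × Bool)} [IsProbabilityMeasure P] {f g : X → Bool}
    (hfg : f =ᵐ[P.fst] g) : risk P f = risk P g := by
  refine measureReal_congr ?_
  have : ∀ᵐ z ∂P, f z.1 = g z.1 := ae_of_ae_map measurable_fst.aemeasurable hfg
  filter_upwards [this] with z hz
  exact propext (by change f z.1 ≠ z.2 ↔ g z.1 ≠ z.2; rw [hz])

theorem integral_excess_eq {P : Measure (X × Bool)} [IsProbabilityMeasure P] {f₀ f : X → Bool}
    (hf₀ : Measurable f₀) (hf : Measurable f) :
    ∫ z, excess f₀ f z ∂P = risk P f - risk P f₀ := by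
  unfold excess
  rw [integral_sub (integrable_loss P hf) (integrable_loss P hf₀), integral_loss P hf,
    integral_loss P hf₀]

/-- Under the bounded noise condition the excess risk dominates `h` times the distance to the
Bayes classifier. -/
theorem mul_integral_disagree_le {P : Measure (X × Bool)} [IsProbabilityMeasure P] {h : ℝ}
    {f₀ f : X → Bool} (hf₀ : Measurable f₀) (hf : Measurable f) (hbayes : f₀ =ᵐ[P.fst] bayes P)
    (hη : ∀ᵐ x ∂P.fst, h ≤ |regression P x|) :
    h * ∫ z, disagree f₀ f z ∂P ≤ ∫ z, excess f₀ f z ∂P := by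
  have hi1 : Integrable (fun z => h * disagree f₀ f z) P :=
    (integrable_disagree P hf₀ hf).const_mul h
  have hi2 := integrable_excess P hf₀ hf
  rw [← integral_const_mul, ← Measure.integral_condKernel hi1, ← Measure.integral_condKernel hi2]
  refine integral_mono_ae hi1.integral_condKernel hi2.integral_condKernel ?_
  filter_upwards [hbayes, hη] with x hx hηx
  have hlab : ∀ y : Bool, excess f₀ f (x, y)
      = (if f₀ x ≠ f x then label (f₀ x) else 0) * label y := by
    intro y
    unfold excess loss label
    cases f x <;> cases f₀ x <;> cases y <;> simp
  have hdis : ∀ y : Bool, h * disagree f₀ f (x, y) = h * if f₀ x ≠ f x then 1 else 0 :=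
    fun y => rfl
  simp only [hlab, hdis]
  rw [integral_const, probReal_univ, one_smul, integral_const_mul]
  change _ ≤ _ * regression P x
  -- Conditionally on `x`, a disagreement with the Bayes classifier costs exactly `|η x|`, which is
  -- at least `h`.
  have habs : label (f₀ x) * regression P x = |regression P x| := by
    rw [hx, bayes, label]
    by_cases h0 : 0 ≤ regression P x
    · simp [h0, abs_of_nonneg]
    · simp [h0, abs_of_neg (not_le.1 h0)]
  split_ifs
  · rw [habs]; linarith
  · simp

theorem integral_sum_eval {P : Measure (X × Bool)} [IsProbabilityMeasure P] {n : ℕ}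
    {u : X × Bool → ℝ} (hu : Integrable u P) :
    ∫ z, ∑ i, u (z i) ∂(sampleLaw P n) = n * ∫ z, u z ∂P := by
  have hint : ∀ i : Fin n, Integrable (fun z : Fin n → X × Bool => u (z i)) (sampleLaw P n) :=
    fun i => (measurePreserving_eval (fun _ : Fin n => P) i).integrable_comp_of_integrable hu
  rw [integral_finsetSum _ fun i _ => hint i]
  have : ∀ i : Fin n, ∫ z, u (z i) ∂(sampleLaw P n) = ∫ z, u z ∂P := fun i =>
    integral_comp_eval (μ := fun _ : Fin n => P) (i := i) hu.aestronglyMeasurable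
  simp [this]

theorem mul_excess_risk_le_integral {P : Measure (X × Bool)} [IsProbabilityMeasure P]
    {F : Set (X → Bool)} {n : ℕ} (hn : 1 ≤ n) {h : ℝ} {A : (Fin n → X × Bool) → X → Bool}
    (hF : ∀ f ∈ F, Measurable f) (hA : IsERM F A) {f₀ : X → Bool} (hf₀ : f₀ ∈ F)
    (hbayes : f₀ =ᵐ[P.fst] bayes P) (hη : ∀ᵐ x ∂P.fst, h ≤ |regression P x|)
    (z : Fin n → X × Bool) :
    n * (risk P (A z) - risk P (bayes P))
      ≤ ∫ z', ghostSum h f₀ (A z) (z, z') ∂(sampleLaw P n) := by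
  have hm₀ := hF f₀ hf₀
  have hm := hF (A z) (hA z).1
  have hu : Integrable (fun y => 2 * excess f₀ (A z) y - h * disagree f₀ (A z) y) P :=
    ((integrable_excess P hm₀ hm).const_mul 2).sub ((integrable_disagree P hm₀ hm).const_mul h)
  have hint : Integrable (fun z' : Fin n → X × Bool =>
      ∑ i, (2 * excess f₀ (A z) (z' i) - h * disagree f₀ (A z) (z' i))) (sampleLaw P n) :=
    integrable_finsetSum _ fun i _ =>
      (measurePreserving_eval (fun _ : Fin n => P) i).integrable_comp_of_integrable hu
  have heq : ∀ z', ghostSum h f₀ (A z) (z, z') =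
      (∑ i, (2 * excess f₀ (A z) (z' i) - h * disagree f₀ (A z) (z' i)))
        - 2 * ∑ i, excess f₀ (A z) (z i) := by
    intro z'
    simp only [ghostSum]
    rw [Finset.sum_sub_distrib, Finset.mul_sum]
  simp only [heq]
  rw [integral_sub hint (integrable_const _), integral_sum_eval hu, integral_const, probReal_univ,
    one_smul, integral_sub ((integrable_excess P hm₀ hm).const_mul 2)
      ((integrable_disagree P hm₀ hm).const_mul h), integral_const_mul, integral_const_mul,
    ← risk_congr hbayes, ← integral_excess_eq hm₀ hm]
  have h1 := mul_integral_disagree_le hm₀ hm hbayes hη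
  have h2 := sum_excess_nonpos hn hA hf₀ z
  have h3 := mul_le_mul_of_nonneg_left h1 (Nat.cast_nonneg (α := ℝ) n)
  linarith

/-- The exponential moment of the excess risk of an empirical risk minimizer. -/
theorem lintegral_exp_excess_risk_le {P : Measure (X × Bool)} [IsProbabilityMeasure P]
    {F : Set (X → Bool)} {n γ : ℕ} (hn : 1 ≤ n) {h : ℝ} (hh : 0 < h) (hh1 : h ≤ 1)
    (hF : ∀ f ∈ F, Measurable f) (hM : Massart P F h) (hP : IsMeasurableClass P F)
    {A : (Fin n → X × Bool) → X → Bool} (hA : IsERM F A)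
    (hγ : tlog ((locPacking F γ n h).toNat : ℝ) ≤ h * γ) :
    ∫⁻ z, ENNReal.ofReal (Real.exp (h / 32 * (n * (risk P (A z) - risk P (bayes P)))))
        ∂(sampleLaw P n) ≤ ENNReal.ofReal (Real.exp (14 * (h * γ))) := by
  obtain ⟨⟨f₀, hf₀, hbayes⟩, hη⟩ := hM
  have hm₀ := hF f₀ hf₀
  refine le_trans ?_ (lintegral_exp_iSup_ghostSum_le hP hh hh1 hγ hf₀ hm₀)
  have hsup : AEMeasurable (fun p => ENNReal.ofReal
      (Real.exp (h / 32 * ⨆ f : F, ghostSum h f₀ f p)))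
      ((sampleLaw P n).prod (sampleLaw P n)) :=
    (Real.measurable_exp.comp_aemeasurable
      ((aemeasurable_iSup_ghostSum hP hh hf₀ hm₀).const_mul _)).ennreal_ofReal
  rw [lintegral_prod _ hsup]
  refine lintegral_mono fun z => ?_
  have hm := hF (A z) (hA z).1
  have hTm : Measurable fun z' : Fin n → X × Bool => ghostSum h f₀ (A z) (z, z') := by
    refine Finset.measurable_sum _ fun i _ => ?_
    exact ((((measurable_excess hm₀ hm).comp (measurable_pi_apply i)).const_mul 2).sub
      (((measurable_disagree hm₀ hm).comp (measurable_pi_apply i)).const_mul h)).sub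
      (measurable_const (a := 2 * excess f₀ (A z) (z i)))
  have hTabs : ∀ z', |ghostSum h f₀ (A z) (z, z')| ≤ 5 * n := by
    intro z'
    calc |ghostSum h f₀ (A z) (z, z')| ≤ ∑ _i : Fin n, (5 : ℝ) := by
          refine (Finset.abs_sum_le_sum_abs _ _).trans (Finset.sum_le_sum fun i _ => ?_)
          have h1 := abs_le.1 (abs_excess_le f₀ (A z) (z i))
          have h2 := abs_le.1 (abs_excess_le f₀ (A z) (z' i))
          have h3 := disagree_nonneg f₀ (A z) (z' i)
          have h4 := disagree_le_one f₀ (A z) (z' i)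
          rw [abs_le]
          constructor <;> nlinarith
      _ = 5 * n := by simp [mul_comm]
  have hTi : Integrable (fun z' => ghostSum h f₀ (A z) (z, z')) (sampleLaw P n) :=
    integrable_of_abs_le hTm hTabs
  have hlTi : Integrable (fun z' => h / 32 * ghostSum h f₀ (A z) (z, z')) (sampleLaw P n) :=
    hTi.const_mul _
  have heTi : Integrable (fun z' => Real.exp (h / 32 * ghostSum h f₀ (A z) (z, z')))
      (sampleLaw P n) := by
    refine integrable_of_abs_le (Real.measurable_exp.comp (hTm.const_mul _))
      (C := Real.exp (h / 32 * (5 * n))) fun z' => ?_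
    rw [Real.abs_exp, Real.exp_le_exp]
    gcongr
    exact (abs_le.1 (hTabs z')).2
  -- The first sample is fixed, so `A z` is a single measurable classifier. The supremum over the
  -- class enters only after Jensen's inequality over the ghost sample.
  have hjensen := convexOn_exp.map_integral_le Real.continuous_exp.continuousOn isClosed_univ
    (Filter.Eventually.of_forall fun _ => Set.mem_univ _) hlTi heTi
  rw [integral_const_mul] at hjensen
  have hrisk := mul_excess_risk_le_integral (P := P) hn hF hA hf₀ hbayes hη z
  calc ENNReal.ofReal (Real.exp (h / 32 * (n * (risk P (A z) - risk P (bayes P)))))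
      ≤ ENNReal.ofReal (∫ z', Real.exp (h / 32 * ghostSum h f₀ (A z) (z, z'))
          ∂(sampleLaw P n)) := by
        refine ENNReal.ofReal_le_ofReal (le_trans ?_ hjensen)
        rw [Real.exp_le_exp]
        gcongr
    _ = ∫⁻ z', ENNReal.ofReal (Real.exp (h / 32 * ghostSum h f₀ (A z) (z, z')))
          ∂(sampleLaw P n) :=
        ofReal_integral_eq_lintegral_ofReal heTi
          (Filter.Eventually.of_forall fun _ => (Real.exp_pos _).le)
    _ ≤ ∫⁻ z', ENNReal.ofReal (Real.exp (h / 32 * ⨆ f : F, ghostSum h f₀ f (z, z')))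
          ∂(sampleLaw P n) := by
        refine lintegral_mono fun z' => ENNReal.ofReal_le_ofReal ?_
        rw [Real.exp_le_exp]
        gcongr
        exact le_ciSup (bddAbove_ghostSum hh F f₀ (z, z')) (⟨A z, (hA z).1⟩ : F)

theorem risk_mem_Icc (P : Measure (X × Bool)) [IsProbabilityMeasure P] (f : X → Bool) :
    risk P f ∈ Set.Icc (0 : ℝ) 1 :=
  ⟨measureReal_nonneg, measureReal_le_one⟩

theorem integral_le_of_lintegral_exp_le {Ω : Type*} [MeasurableSpace Ω] {μ : Measure Ω}
    [IsProbabilityMeasure μ] {Z : Ω → ℝ} (hZ : AEMeasurable Z μ) {M b : ℝ}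
    (hM : ∀ ω, |Z ω| ≤ M)
    (hexp : ∫⁻ ω, ENNReal.ofReal (Real.exp (Z ω)) ∂μ ≤ ENNReal.ofReal (Real.exp b)) :
    ∫ ω, Z ω ∂μ ≤ b := by
  have hZi : Integrable Z μ :=
    Integrable.of_bound hZ.aestronglyMeasurable M (Filter.Eventually.of_forall hM)
  have hei : Integrable (fun ω => Real.exp (Z ω)) μ := by
    refine Integrable.of_bound (Real.measurable_exp.comp_aemeasurable hZ).aestronglyMeasurable
      (Real.exp M) (Filter.Eventually.of_forall fun ω => ?_)
    rw [Real.norm_eq_abs, Real.abs_exp, Real.exp_le_exp]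
    exact (abs_le.1 (hM ω)).2
  have hjensen := convexOn_exp.map_integral_le Real.continuous_exp.continuousOn isClosed_univ
    (Filter.Eventually.of_forall fun _ => Set.mem_univ _) hZi hei
  rw [← ofReal_integral_eq_lintegral_ofReal hei
    (Filter.Eventually.of_forall fun _ => (Real.exp_pos _).le),
    ENNReal.ofReal_le_ofReal_iff (Real.exp_pos _).le] at hexp
  exact Real.exp_le_exp.1 (hjensen.trans hexp)

theorem one_sub_le_measureReal_of_lintegral_exp_le {Ω : Type*} [MeasurableSpace Ω] {μ : Measure Ω}
    [IsProbabilityMeasure μ] {Z : Ω → ℝ} (hZ : AEMeasurable Z μ) {b t : ℝ}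
    (hexp : ∫⁻ ω, ENNReal.ofReal (Real.exp (Z ω)) ∂μ ≤ ENNReal.ofReal (Real.exp b)) :
    1 - Real.exp (-t) ≤ μ.real {ω | Z ω ≤ b + t} := by
  have hem : AEMeasurable (fun ω => ENNReal.ofReal (Real.exp (Z ω))) μ :=
    (Real.measurable_exp.comp_aemeasurable hZ).ennreal_ofReal
  have hmarkov := mul_meas_ge_le_lintegral₀ hem (ENNReal.ofReal (Real.exp (b + t)))
  have hbad : μ {ω | b + t < Z ω} ≤ ENNReal.ofReal (Real.exp (-t)) := by
    have hsub : {ω | b + t < Z ω} ⊆ {ω | ENNReal.ofReal (Real.exp (b + t))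
        ≤ ENNReal.ofReal (Real.exp (Z ω))} := fun ω hω =>
      ENNReal.ofReal_le_ofReal (Real.exp_le_exp.2 (le_of_lt hω))
    have h1 : ENNReal.ofReal (Real.exp (b + t)) * μ {ω | b + t < Z ω}
        ≤ ENNReal.ofReal (Real.exp (b + t)) * ENNReal.ofReal (Real.exp (-t)) := by
      rw [← ENNReal.ofReal_mul (Real.exp_pos _).le, ← Real.exp_add, add_neg_cancel_right]
      exact (mul_le_mul_right (measure_mono hsub) _).trans (hmarkov.trans hexp)
    exact (ENNReal.mul_le_mul_iff_right (by simp [Real.exp_pos]) ENNReal.ofReal_ne_top).1 h1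
  have hnull : NullMeasurableSet {ω | Z ω ≤ b + t} μ :=
    nullMeasurableSet_le hZ aemeasurable_const
  have hcompl : {ω | Z ω ≤ b + t}ᶜ = {ω | b + t < Z ω} := by ext ω; simp
  have h2 := measureReal_compl₀ hnull
  rw [hcompl, probReal_univ] at h2
  have h3 : μ.real {ω | b + t < Z ω} ≤ Real.exp (-t) :=
    ENNReal.toReal_le_of_le_ofReal (Real.exp_pos _).le hbad
  linarith

theorem erm_bounds {P : Measure (X × Bool)} [IsProbabilityMeasure P] {F : Set (X → Bool)} {n : ℕ}
    (hn : 1 ≤ n) {h : ℝ} (hh : 0 < h) (hh1 : h ≤ 1) (hF : ∀ f ∈ F, Measurable f)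
    (hM : Massart P F h) (hP : IsMeasurableClass P F) {A : (Fin n → X × Bool) → X → Bool}
    (hA : IsERM F A) (hAm : AEMeasurable (fun z => risk P (A z)) (sampleLaw P n)) :
    (∫ z, (risk P (A z) - risk P (bayes P)) ∂(sampleLaw P n)
      ≤ 1000 * ((gammaLoc F n h h : ℝ) / n)) ∧
    ∀ δ : ℝ, 0 < δ → 1 - δ ≤ (sampleLaw P n).real
      {z | risk P (A z) - risk P (bayes P)
        ≤ 1000 * ((gammaLoc F n h h : ℝ) / n + tlog (1 / δ) / (n * h))} := by
  set γ := gammaLoc F n h h with hγ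
  have hγ1 : (1 : ℝ) ≤ γ := by exact_mod_cast one_le_gammaLoc hh hh1
  have hn0 : (0 : ℝ) < n := by exact_mod_cast hn
  -- The entropy inequality holds at `γ + 1`, the first integer above the fixed point. The extra 1
  -- is later absorbed through `1 ≤ γ`.
  have hexp := lintegral_exp_excess_risk_le hn hh hh1 hF hM hP hA
    (tlog_lt_succ_gammaLoc (F := F) (n := n) (h' := h) hh).le
  rw [← hγ] at hexp
  push_cast at hexp
  have hZm : AEMeasurable (fun z => h / 32 * (n * (risk P (A z) - risk P (bayes P))))
      (sampleLaw P n) := ((hAm.sub_const _).const_mul _).const_mul _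
  constructor
  · have hb : ∀ z, |h / 32 * (n * (risk P (A z) - risk P (bayes P)))| ≤ h / 32 * (n * 1) := by
      intro z
      rw [abs_mul, abs_mul, abs_of_pos (by positivity : 0 < h / 32), abs_of_pos hn0]
      obtain ⟨h1, h2⟩ := risk_mem_Icc P (A z)
      obtain ⟨h3, h4⟩ := risk_mem_Icc P (bayes P)
      gcongr
      rw [abs_le]
      constructor <;> linarith
    have h1 := integral_le_of_lintegral_exp_le hZm hb hexp
    rw [integral_const_mul, integral_const_mul] at h1
    rw [mul_div_assoc', le_div_iff₀ hn0]
    -- Here `448 = 14 * 32`, and `448 * (γ + 1) ≤ 896 * γ`.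
    have h2 : h * (n * ∫ z, (risk P (A z) - risk P (bayes P)) ∂(sampleLaw P n))
        ≤ h * (448 * (γ + 1)) := by linarith
    have h3 := le_of_mul_le_mul_left h2 hh
    linarith
  · intro δ hδ
    have h1 := one_sub_le_measureReal_of_lintegral_exp_le (t := Real.log (1 / δ)) hZm hexp
    have h2 : Real.exp (-Real.log (1 / δ)) = δ := by
      rw [one_div, Real.log_inv, neg_neg, Real.exp_log hδ]
    rw [h2] at h1
    refine h1.trans (measureReal_mono ?_)
    intro z hz
    change h / 32 * (n * (risk P (A z) - risk P (bayes P)))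
      ≤ 14 * (h * (γ + 1)) + Real.log (1 / δ) at hz
    change risk P (A z) - risk P (bayes P) ≤ 1000 * (γ / n + tlog (1 / δ) / (n * h))
    have h3 : Real.log (1 / δ) ≤ tlog (1 / δ) := log_le_tlog (by positivity)
    have h4 := one_le_tlog (1 / δ)
    have h5 : 1000 * ((γ : ℝ) / n + tlog (1 / δ) / (n * h))
        = (1000 * (h * γ + tlog (1 / δ))) / (n * h) := by field_simp
    rw [h5, le_div_iff₀ (by positivity)]
    have h6 : h * 1 ≤ h * γ := by gcongr
    linarith

end ERM

end LocalEntropy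

end

theorem theorem5p1 :
    ∃ C : ℝ, 0 < C ∧
      ∀ {X : Type*} [MeasurableSpace X] (F : Set (X → Bool)) (n d : ℕ) (h : ℝ),
        (∀ f ∈ F, Measurable f) →
        1 ≤ n → 1 ≤ d → LocalEntropy.vcDim F = d →
        Real.sqrt (d / n) < h → h ≤ 1 →
        (∀ (P : MeasureTheory.Measure (X × Bool)) [MeasureTheory.IsProbabilityMeasure P],
          LocalEntropy.Massart P F h →
          LocalEntropy.IsMeasurableClass P F →
          ∀ A : (Fin n → X × Bool) → X → Bool,
            LocalEntropy.IsERM F A →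
            AEMeasurable (fun z => LocalEntropy.risk P (A z)) (LocalEntropy.sampleLaw P n) →
            (∫ z, (LocalEntropy.risk P (A z) - LocalEntropy.risk P (LocalEntropy.bayes P))
                ∂(LocalEntropy.sampleLaw P n)
              ≤ C * ((LocalEntropy.gammaLoc F n h h : ℝ) / n)) ∧
            ∀ δ : ℝ, 0 < δ → δ < 1 →
              1 - δ ≤ (LocalEntropy.sampleLaw P n).real
                {z | LocalEntropy.risk P (A z) - LocalEntropy.risk P (LocalEntropy.bayes P)
                  ≤ C * ((LocalEntropy.gammaLoc F n h h : ℝ) / n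
                      + LocalEntropy.tlog (1 / δ) / (n * h))}) ∧
        ((d : ℝ) + LocalEntropy.tlog
            (LocalEntropy.minENat (n * h ^ 2) (LocalEntropy.starNumber F))) / h
          ≤ C * (LocalEntropy.gammaLoc F n h h : ℝ) ∧
        (LocalEntropy.gammaLoc F n h h : ℝ)
          ≤ C * (d * LocalEntropy.tlog
                (LocalEntropy.minENat (n * h ^ 2 / d) (LocalEntropy.starNumber F)) / h
              + d * LocalEntropy.tlog (1 / h) / h) := by
  -- The constants needed are 896 for the risk bounds, `64 + 8` for the lower bound and 8 for the
  -- upper bound on the fixed point.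
  refine ⟨1000, by norm_num, ?_⟩
  intro X _ F n d h hF hn hd hvc hsqrt hh1
  have hh : 0 < h := (Real.sqrt_nonneg _).trans_lt hsqrt
  have hn0 : (0 : ℝ) < n := by exact_mod_cast hn
  have hdn : (d : ℝ) < n * h ^ 2 := by
    have := (Real.sqrt_lt' hh).1 hsqrt
    rw [div_lt_iff₀ hn0] at this
    linarith
  have hγ0 : (0 : ℝ) ≤ LocalEntropy.gammaLoc F n h h := Nat.cast_nonneg _
  refine ⟨?_, ?_, ?_⟩
  · intro P _ hM hP A hA hAm
    obtain ⟨h1, h2⟩ := LocalEntropy.erm_bounds hn hh hh1 hF hM hP hA hAm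
    exact ⟨h1, fun δ hδ _ => h2 δ hδ⟩
  · have h1 := LocalEntropy.dim_div_le_gammaLoc hd hvc hh hh1 hdn
    have h2 := LocalEntropy.tlog_min_star_div_le_gammaLoc (F := F) (n := n) hh hh1
    rw [add_div]
    linarith
  · refine (LocalEntropy.gammaLoc_le hd hvc hh).trans ?_
    have h1 := LocalEntropy.one_le_tlog
      (LocalEntropy.minENat (n * h ^ 2 / d) (LocalEntropy.starNumber F))
    have h2 := LocalEntropy.one_le_tlog (1 / h)
    gcongr
    norm_num
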